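/- Let $\sigma_1,\sigma_2$ be the Pauli matrices, $\gamma_{15}=\operatorname{diag}(\sigma_1,\sigma_1)$, $\gamma_{25}=\operatorname{diag}(\sigma_2,\sigma_2)$ and $t(\theta)=\cos(2\pi\theta)\gamma_{15}+\sin(2\pi\theta)\gamma_{25}$. Let $U(x)=\frac{1+2\cos(2\pi x)}{3}$ and $U_c^{\pm}(x)=\frac{1-\cos(2\pi x)\pm\sqrt3\sin(2\pi x)}{3}$. For $L>0$, $w=(w_0,w_1)\in[0,\infty)^2$, $\theta,\phi\in\mathbb R$ and $\vartheta\in[0,1]$, the Dirac–Harper Hamiltonian $H=H_w(\theta,\phi,\vartheta)$ is the bounded operator on $\ell^2(\mathbb Z;\mathbb C^4)$ given by $$(H\psi)_n=t(\theta)\psi_{n+1}+t(\theta)\psi_{n-1}+\gamma_{15}\psi_n+V(n)\psi_n,$$ $$V(n)=\begin{pmatrix}0&W(n)\\W(n)^*&0\end{pmatrix},\qquad W(n)=\begin{pmatrix}w_0U(\vartheta+\tfrac{n-\phi}{L})&w_1U_c^-(\vartheta+\tfrac nL)\\ w_1U_c^+(\vartheta+\tfrac nL)&w_0U(\vartheta+\tfrac{n+\phi}{L})\end{pmatrix}.$$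 **Proposition 3.1.** Suppose that $1/L\in\mathbb Q$. Then: 1. $H$ has purely absolutely continuous spectrum, i.e. $H$ is self-adjoint and, for every $\psi\in\ell^2(\mathbb Z;\mathbb C^4)$, its spectral measure at $\psi$ is absolutely continuous with respect to Lebesgue measure. 2. The density of states of $H$ exists and is continuous: there is a finite Borel measure $\nu$ on $\mathbb R$ such that $$\lim_{N\to\infty}\frac{\operatorname{tr}\big(\mathbf 1_{\{-N,\dots,N\}}f(H)\big)}{2N+1}=\int_{\mathbb R}f\,d\nu\qquad\text{for all }f\in C_c^\infty(\mathbb R),$$ its distribution function $E\mapsto\nu((-\infty,E])$ is continuous on $\mathbb R$, and, for every $E\in\mathbb R$, $$\lim_{N\to\infty}\frac{\operatorname{tr}\big(\mathbf 1_{\{-N,\dots,N\}}\mathbf 1_{(-\infty,E]}(H)\big)}{2N+1}=\nu((-\infty,E]).$$ -/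

import Mathlib

open scoped CompactlySupported InnerProductSpace

noncomputable section

/-! ### Spectral measures of a bounded self-adjoint operator -/

namespace SpectralTheory

variable {E : Type*} [NormedAddCommGroup E] [InnerProductSpace ℂ E] [CompleteSpace E]

/-- The operator `f(T)`, for a bounded self-adjoint operator `T` and a continuous function `f`, given
by Mathlib's continuous functional calculus. -/
def functionalCalculus (T : E →L[ℂ] E) (f : ℝ → ℝ) : E →L[ℂ] E := cfc f T

/-- The positive linear functional `f ↦ ⟨ψ, f(T) ψ⟩` on `C_c(ℝ, ℝ)` for a
bounded self-adjoint operator `T`. -/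
def spectralFunctional (T : E →L[ℂ] E) (ψ : E) : C_c(ℝ, ℝ) →ₚ[ℝ] ℝ :=
  PositiveLinearMap.mk₀
    { toFun := fun f => (⟪ψ, functionalCalculus T (fun x => f x) ψ⟫_ℂ).re
      map_add' := fun f g => by
        have h : functionalCalculus T (fun x => (f + g) x) =
            functionalCalculus T (fun x => f x) + functionalCalculus T (fun x => g x) :=
          cfc_add T (fun x => f x) (fun x => g x) f.continuous.continuousOn
            g.continuous.continuousOn
        rw [h, _root_.add_apply, inner_add_right, Complex.add_re]
      map_smul' := fun c f => by
        have h : functionalCalculus T (fun x => (c • f) x) =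
            c • functionalCalculus T (fun x => f x) :=
          cfc_smul c (fun x => f x) T f.continuous.continuousOn
        rw [h, _root_.smul_apply, RCLike.real_smul_eq_coe_smul (K := ℂ),
          inner_smul_right]
        simp }
    (fun f hf => by
      have h : (0 : E →L[ℂ] E) ≤ functionalCalculus T (fun x => f x) := cfc_nonneg fun x _ => hf x
      exact ((ContinuousLinearMap.nonneg_iff_isPositive _).1 h).re_inner_nonneg_right ψ)

/-- The spectral measure `μ_ψ` of the bounded self-adjoint operator `T` at the vector `ψ`: the
Riesz–Markov–Kakutani measure with `∫ f dμ_ψ = ⟨ψ, f(T) ψ⟩` for all `f ∈ C_c(ℝ)`.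
Equivalently, `μ_ψ(B) = ⟨ψ, 1_B(T) ψ⟩` for Borel sets `B`. -/
def spectralMeasure (T : E →L[ℂ] E) (ψ : E) : MeasureTheory.Measure ℝ :=
  RealRMK.rieszMeasure (spectralFunctional T ψ)

theorem integral_spectralMeasure (T : E →L[ℂ] E) (ψ : E) (f : C_c(ℝ, ℝ)) :
    ∫ x, f x ∂(spectralMeasure T ψ) = (⟪ψ, functionalCalculus T (fun x => f x) ψ⟫_ℂ).re :=
  RealRMK.integral_rieszMeasure (spectralFunctional T ψ) f

/-- A bounded operator has purely absolutely continuous spectrum if it is self-adjoint and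
the spectral measure of every vector is absolutely continuous with respect to Lebesgue measure. -/
def HasPurelyACSpectrum (T : E →L[ℂ] E) : Prop :=
  IsSelfAdjoint T ∧
    ∀ ψ : E, MeasureTheory.Measure.AbsolutelyContinuous (spectralMeasure T ψ)
      MeasureTheory.volume

end SpectralTheory

namespace DiracHarper

/-! ### The Hilbert space `ℓ²(ℤ; ℂ⁴)`, shifts and block multiplication operators -/

/-- The fibre `ℂ⁴` with its Hermitian inner product. -/
abbrev Fibre : Type := EuclideanSpace ℂ (Fin 4)

/-- The Hilbert space `ℓ²(ℤ; ℂ⁴)`. -/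
abbrev Space : Type := lp (fun _ : ℤ => Fibre) 2

theorem memℓp_shift (k : ℤ) (ψ : Space) : Memℓp (fun n : ℤ => ψ (n + k)) 2 := by
  have h := (lp.memℓp ψ).summable (by norm_num)
  exact memℓp_gen (h.comp_injective (add_left_injective k))

/-- The translation `(shift k ψ)_n = ψ_{n+k}` on `ℓ²(ℤ; ℂ⁴)`. -/
def shift (k : ℤ) : Space →L[ℂ] Space :=
  LinearMap.mkContinuous
    { toFun := fun ψ => ⟨fun n => ψ (n + k), memℓp_shift k ψ⟩
      map_add' := fun _ _ => rfl
      map_smul' := fun _ _ => rfl } 1 (fun ψ => by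
      refine lp.norm_le_of_tsum_le (by norm_num) (by positivity) ?_
      rw [one_mul, lp.norm_rpow_eq_tsum (by norm_num) ψ]
      exact ((Equiv.addRight k).tsum_eq (fun n => ‖ψ n‖ ^ (2 : ENNReal).toReal)).le)

@[simp] theorem shift_apply (k : ℤ) (ψ : Space) (n : ℤ) : shift k ψ n = ψ (n + k) := rfl

theorem memℓp_block (A : ℤ → Fibre →L[ℂ] Fibre) {C : ℝ} (hA : ∀ n, ‖A n‖ ≤ C) (ψ : Space) :
    Memℓp (fun n : ℤ => A n (ψ n)) 2 := by
  have hC : 0 ≤ C := (norm_nonneg _).trans (hA 0)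
  refine Memℓp.mono' (((lp.memℓp ψ)).const_smul (C : ℂ)) fun n => ?_
  rw [Pi.smul_apply, norm_smul, Complex.norm_real, Real.norm_of_nonneg hC]
  exact (A n).le_of_opNorm_le (hA n) _

/-- Multiplication by a bounded sequence of operators on `ℂ⁴`: `(block A ψ)_n = A_n ψ_n`. -/
def block (A : ℤ → Fibre →L[ℂ] Fibre) {C : ℝ} (hA : ∀ n, ‖A n‖ ≤ C) : Space →L[ℂ] Space :=
  LinearMap.mkContinuous
    { toFun := fun ψ => ⟨fun n => A n (ψ n), memℓp_block A hA ψ⟩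
      map_add' := fun ψ χ => by ext n : 2; exact map_add (A n) (ψ n) (χ n)
      map_smul' := fun c ψ => by ext n : 2; exact map_smul (A n) c (ψ n) } C (fun ψ => by
      have hC : 0 ≤ C := (norm_nonneg _).trans (hA 0)
      have hn : ‖(C : ℂ) • ψ‖ = C * ‖ψ‖ := by
        rw [norm_smul, Complex.norm_real, Real.norm_of_nonneg hC]
      rw [← hn]
      refine lp.norm_mono (by norm_num) fun n => ?_
      change ‖A n (ψ n)‖ ≤ ‖(C : ℂ) • ψ n‖
      rw [norm_smul, Complex.norm_real, Real.norm_of_nonneg hC]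
      exact (A n).le_of_opNorm_le (hA n) _)

@[simp] theorem block_apply (A : ℤ → Fibre →L[ℂ] Fibre) {C : ℝ} (hA : ∀ n, ‖A n‖ ≤ C)
    (ψ : Space) (n : ℤ) : block A hA ψ n = A n (ψ n) := rfl

/-! ### The Dirac–Harper Hamiltonian -/

/-- `γ₁₅ = diag(σ₁, σ₁)`. -/
def gamma15 : Matrix (Fin 4) (Fin 4) ℂ :=
  !![0, 1, 0, 0;
     1, 0, 0, 0;
     0, 0, 0, 1;
     0, 0, 1, 0]

/-- `γ₂₅ = diag(σ₂, σ₂)`. -/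
def gamma25 : Matrix (Fin 4) (Fin 4) ℂ :=
  !![0, -Complex.I, 0, 0;
     Complex.I, 0, 0, 0;
     0, 0, 0, -Complex.I;
     0, 0, Complex.I, 0]

/-- The hopping matrix `t(θ) = cos(2πθ) γ₁₅ + sin(2πθ) γ₂₅`. -/
def hopping (θ : ℝ) : Matrix (Fin 4) (Fin 4) ℂ :=
  (Real.cos (2 * Real.pi * θ) : ℂ) • gamma15 + (Real.sin (2 * Real.pi * θ) : ℂ) • gamma25

/-- The anti-chiral tunnelling profile `U(x) = (1 + 2 cos(2πx)) / 3`. -/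
def profileU (x : ℝ) : ℝ := (1 + 2 * Real.cos (2 * Real.pi * x)) / 3

/-- The chiral profile `U_c^+(x) = (1 - cos(2πx) + √3 sin(2πx)) / 3`. -/
def profilePlus (x : ℝ) : ℝ :=
  (1 - Real.cos (2 * Real.pi * x) + √3 * Real.sin (2 * Real.pi * x)) / 3

/-- The chiral profile `U_c^-(x) = (1 - cos(2πx) - √3 sin(2πx)) / 3`. -/
def profileMinus (x : ℝ) : ℝ :=
  (1 - Real.cos (2 * Real.pi * x) - √3 * Real.sin (2 * Real.pi * x)) / 3

/-- The tunnelling potential at the site `n`, with coupling strengths `w₀` (anti-chiral) and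
`w₁` (chiral), moiré length `L`, dislocation `φ` and offset `ϑ`. -/
def potential (L w₀ w₁ φ ϑ : ℝ) (n : ℤ) : Matrix (Fin 4) (Fin 4) ℂ :=
  let a : ℂ := ((w₀ * profileU (ϑ + (n - φ) / L) : ℝ) : ℂ)
  let b : ℂ := ((w₀ * profileU (ϑ + (n + φ) / L) : ℝ) : ℂ)
  let p : ℂ := ((w₁ * profilePlus (ϑ + n / L) : ℝ) : ℂ)
  let m : ℂ := ((w₁ * profileMinus (ϑ + n / L) : ℝ) : ℂ)
  !![0, 0, a, m;
     0, 0, p, b;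
     a, p, 0, 0;
     m, b, 0, 0]

/-- The action of a `4 × 4` matrix on the Hilbert space `ℂ⁴`. -/
abbrev act (A : Matrix (Fin 4) (Fin 4) ℂ) : Fibre →L[ℂ] Fibre :=
  Matrix.toEuclideanCLM (𝕜 := ℂ) (n := Fin 4) A

theorem exists_norm_act_le (A : ℤ → Matrix (Fin 4) (Fin 4) ℂ) (C : ℝ)
    (hA : ∀ n i j, ‖A n i j‖ ≤ C) : ∃ D : ℝ, ∀ n, ‖act (A n)‖ ≤ D := by
  have hK : IsCompact (Set.univ.pi fun _ : Fin 4 => Set.univ.pi fun _ : Fin 4 =>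
      Metric.closedBall (0 : ℂ) C) :=
    isCompact_univ_pi fun _ => isCompact_univ_pi fun _ => isCompact_closedBall _ _
  have hc : Continuous fun M : Fin 4 → Fin 4 → ℂ => act (Matrix.of M) :=
    LinearMap.continuous_of_finiteDimensional
      ({ toFun := fun M : Fin 4 → Fin 4 → ℂ => act (Matrix.of M)
         map_add' := fun M N => map_add (Matrix.toEuclideanCLM (𝕜 := ℂ) (n := Fin 4)) _ _
         map_smul' := fun c M => map_smul (Matrix.toEuclideanCLM (𝕜 := ℂ) (n := Fin 4)) c _ } :
        (Fin 4 → Fin 4 → ℂ) →ₗ[ℂ] (Fibre →L[ℂ] Fibre))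
  obtain ⟨D, hD⟩ := (hK.image hc).isBounded.exists_norm_le
  refine ⟨D, fun n => hD _ ⟨fun i j => A n i j, ?_, rfl⟩⟩
  intro i _ j _
  simpa using hA n i j

theorem norm_profileU_le (x : ℝ) : |profileU x| ≤ 1 := by
  have h1 := Real.neg_one_le_cos (2 * Real.pi * x)
  have h2 := Real.cos_le_one (2 * Real.pi * x)
  rw [profileU, abs_le]; constructor <;> linarith

theorem norm_profile_aux (c s : ℝ) (hc : |c| ≤ 1) (hs : |s| ≤ 1) (r : ℝ) (hr : |r| ≤ 2) :
    |(1 - c + r * s) / 3| ≤ 2 := by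
  have h : |r * s| ≤ 2 := by
    rw [abs_mul]; nlinarith [abs_nonneg r, abs_nonneg s]
  rw [abs_le] at h hc ⊢
  constructor <;> linarith [hc.1, hc.2, h.1, h.2]

theorem sqrt_three_le : |√(3 : ℝ)| ≤ 2 := by
  rw [abs_of_nonneg (Real.sqrt_nonneg _), Real.sqrt_le_left (by norm_num)]; norm_num

theorem norm_profilePlus_le (x : ℝ) : |profilePlus x| ≤ 2 :=
  norm_profile_aux _ _ (Real.abs_cos_le_one _) (Real.abs_sin_le_one _) _ sqrt_three_le

theorem norm_profileMinus_le (x : ℝ) : |profileMinus x| ≤ 2 := by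
  have := norm_profile_aux _ _ (Real.abs_cos_le_one (2 * Real.pi * x))
    (Real.abs_sin_le_one (2 * Real.pi * x)) (-√3) (by rw [abs_neg]; exact sqrt_three_le)
  rw [profileMinus]; rwa [neg_mul, ← sub_eq_add_neg] at this

theorem norm_potential_le (L w₀ w₁ φ ϑ : ℝ) (n : ℤ) (i j : Fin 4) :
    ‖potential L w₀ w₁ φ ϑ n i j‖ ≤ |w₀| + 2 * |w₁| := by
  have ha : ∀ x, ‖((w₀ * profileU x : ℝ) : ℂ)‖ ≤ |w₀| + 2 * |w₁| := fun x => by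
    rw [Complex.norm_real, Real.norm_eq_abs, abs_mul]
    nlinarith [norm_profileU_le x, abs_nonneg w₀, abs_nonneg w₁]
  have hp : ∀ x, ‖((w₁ * profilePlus x : ℝ) : ℂ)‖ ≤ |w₀| + 2 * |w₁| := fun x => by
    rw [Complex.norm_real, Real.norm_eq_abs, abs_mul]
    nlinarith [norm_profilePlus_le x, abs_nonneg w₀, abs_nonneg w₁]
  have hm : ∀ x, ‖((w₁ * profileMinus x : ℝ) : ℂ)‖ ≤ |w₀| + 2 * |w₁| := fun x => by
    rw [Complex.norm_real, Real.norm_eq_abs, abs_mul]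
    nlinarith [norm_profileMinus_le x, abs_nonneg w₀, abs_nonneg w₁]
  have h0 : ‖(0 : ℂ)‖ ≤ |w₀| + 2 * |w₁| := by rw [norm_zero]; positivity
  fin_cases i <;> fin_cases j <;>
    first | exact h0 | exact ha _ | exact hp _ | exact hm _

theorem exists_bound_potential (L w₀ w₁ φ ϑ : ℝ) :
    ∃ D : ℝ, ∀ n, ‖act (potential L w₀ w₁ φ ϑ n)‖ ≤ D :=
  exists_norm_act_le _ _ (norm_potential_le L w₀ w₁ φ ϑ)

/-- The Dirac–Harper Hamiltonian `H_w(θ, φ, ϑ)` with moiré length `L` on `ℓ²(ℤ; ℂ⁴)`,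
`(H ψ)_n = t(θ) ψ_{n+1} + t(θ) ψ_{n-1} + γ₁₅ ψ_n + V_w(ϑ + n/L, φ) ψ_n`. -/
def hamiltonian (L w₀ w₁ θ φ ϑ : ℝ) : Space →L[ℂ] Space :=
  block (fun _ => act (hopping θ)) (fun _ => le_rfl) ∘L (shift 1 + shift (-1)) +
    block (fun _ => act gamma15) (fun _ => le_rfl) +
    block (fun n => act (potential L w₀ w₁ φ ϑ n)) (exists_bound_potential L w₀ w₁ φ ϑ).choose_spec

theorem hamiltonian_apply (L w₀ w₁ θ φ ϑ : ℝ) (ψ : Space) (n : ℤ) :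
    hamiltonian L w₀ w₁ θ φ ϑ ψ n =
      act (hopping θ) (ψ (n + 1)) + act (hopping θ) (ψ (n - 1)) + act gamma15 (ψ n) +
        act (potential L w₀ w₁ φ ϑ n) (ψ n) := by
  have h : hamiltonian L w₀ w₁ θ φ ϑ ψ n =
      act (hopping θ) (ψ (n + 1) + ψ (n + -1)) + act gamma15 (ψ n) +
        act (potential L w₀ w₁ φ ϑ n) (ψ n) := rfl
  rw [h, map_add, sub_eq_add_neg]

/-! ### Density of states -/

/-- The standard basis vector `δ_n ⊗ e_j` of `ℓ²(ℤ; ℂ⁴)`. -/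
def basisVec (n : ℤ) (j : Fin 4) : Space :=
  lp.single 2 n (EuclideanSpace.single j (1 : ℂ))

/-- The normalized local trace `tr(1_{-N,…,N} A) / (2N + 1)`. -/
def localTrace (N : ℕ) (A : Space →L[ℂ] Space) : ℂ :=
  (∑ n ∈ Finset.Icc (-(N : ℤ)) N, ∑ j : Fin 4, ⟪basisVec n j, A (basisVec n j)⟫_ℂ) /
    (2 * (N : ℂ) + 1)

/-- `ν` is the density of states measure of `H`: for every test function `f ∈ C_c^∞(ℝ)`,
the regularized trace of `f(H)` exists and equals `∫ f dν`. -/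
def IsDensityOfStates (H : Space →L[ℂ] Space) (ν : MeasureTheory.Measure ℝ) : Prop :=
  MeasureTheory.IsFiniteMeasure ν ∧
    ∀ f : ℝ → ℝ, ContDiff ℝ ((⊤ : ℕ∞) : WithTop ℕ∞) f → HasCompactSupport f →
      Filter.Tendsto (fun N : ℕ => localTrace N (SpectralTheory.functionalCalculus H f)) Filter.atTop
        (nhds ((∫ x, f x ∂ν : ℝ) : ℂ))

/-- The finite-volume integrated density of states `tr(1_{-N,…,N} 1_{(-∞,E]}(H)) / (2N + 1)`,
with the diagonal entries of the spectral projection given by spectral measures. -/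
def localIDS (H : Space →L[ℂ] Space) (N : ℕ) (E : ℝ) : ℝ :=
  (∑ n ∈ Finset.Icc (-(N : ℤ)) N, ∑ j : Fin 4,
    (SpectralTheory.spectralMeasure H (basisVec n j)).real (Set.Iic E)) / (2 * (N : ℝ) + 1)

end DiracHarper

end

/-! Since `1/L` is rational, the potential is periodic with period `q = r.den`, and Floquet theory
turns `H` into a family of Hermitian `4q × 4q` Bloch matrices `A(k)`. Diagonal entries of `f(H)` are
averages over `k ∈ [0,1]` of diagonal entries of `f(A(k))`
(`IsPeriodicJacobi.spectralForm_basisVec`).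

Absolute continuity amounts to this: for a null set `N` of energies, almost no `A(k)` has an
eigenvalue in `N`. The function `D(k,e) = det(e - A(k))` is real analytic. At a zero of finite order
in `k`, some `k`-derivative of `D` has a simple zero, whose zero set is locally a Lipschitz graph
over the `e`-axis, and Lipschitz maps preserve null sets (`volume_fst_zeros_eq_zero`). Zeros of
infinite order would be flat bands. They are excluded because the hopping matrix is invertible:
solutions at energy `e` form a finite-dimensional space, translation by a period has finitely many
eigenvalues on it, and `D(k,e) = 0` makes `exp(2πiqk)` one of them
(`not_eventually_dispersion_eq_zero`). A density argument passes from basis vectors to all vectors.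

For the density of states, the spectral measures at the basis vectors are `q`-periodic in the site,
so the local traces are averages of periodic sequences. Their limit `ν` is the mean over one period;
it inherits absolute continuity, hence has no atoms. -/

noncomputable section

open MeasureTheory Filter Topology
open scoped ContDiff InnerProductSpace Matrix NNReal

/-! ### Spectral forms, tent functions and null sets of spectral measures. -/

namespace SpectralTheory

variable {E : Type*} [NormedAddCommGroup E] [InnerProductSpace ℂ E] [CompleteSpace E]

/-- The quadratic form `Re ⟨ψ, f(T) ψ⟩`. -/
def spectralForm (T : E →L[ℂ] E) (f : ℝ → ℝ) (ψ : E) : ℝ :=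
  (⟪ψ, functionalCalculus T f ψ⟫_ℂ).re

theorem spectralForm_nonneg (T : E →L[ℂ] E) {f : ℝ → ℝ} (hf : ∀ x, 0 ≤ f x) (ψ : E) :
    0 ≤ spectralForm T f ψ := by
  have h : (0 : E →L[ℂ] E) ≤ functionalCalculus T f := cfc_nonneg fun x _ => hf x
  exact ((ContinuousLinearMap.nonneg_iff_isPositive _).1 h).re_inner_nonneg_right ψ

theorem spectralForm_le (T : E →L[ℂ] E) {f : ℝ → ℝ} (hf : ∀ x, |f x| ≤ 1) (ψ : E) :
    spectralForm T f ψ ≤ ‖ψ‖ ^ 2 := by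
  have h : ‖functionalCalculus T f‖ ≤ 1 := norm_cfc_le zero_le_one fun x _ => hf x
  calc spectralForm T f ψ ≤ ‖⟪ψ, functionalCalculus T f ψ⟫_ℂ‖ := Complex.re_le_norm _
    _ ≤ ‖ψ‖ * ‖functionalCalculus T f ψ‖ := norm_inner_le_norm _ _
    _ ≤ ‖ψ‖ * (1 * ‖ψ‖) := by
      gcongr
      exact ContinuousLinearMap.le_of_opNorm_le _ h ψ
    _ = ‖ψ‖ ^ 2 := by ring

theorem spectralForm_smul (T : E →L[ℂ] E) (f : ℝ → ℝ) (c : ℂ) (ψ : E) :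
    spectralForm T f (c • ψ) = ‖c‖ ^ 2 * spectralForm T f ψ := by
  have h : (starRingEnd ℂ c) * c = ((‖c‖ ^ 2 : ℝ) : ℂ) := by
    rw [mul_comm, Complex.mul_conj, Complex.normSq_eq_norm_sq]
  rw [spectralForm, map_smul, inner_smul_left, inner_smul_right, ← mul_assoc, h,
    Complex.re_ofReal_mul, spectralForm]

theorem spectralForm_add_le (T : E →L[ℂ] E) {f : ℝ → ℝ} (hf : ∀ x, 0 ≤ f x) (ψ η : E) :
    spectralForm T f (ψ + η) ≤ 2 * spectralForm T f ψ + 2 * spectralForm T f η := by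
  -- Parallelogram law; the term at `ψ - η` is nonnegative and gets dropped.
  have h : spectralForm T f (ψ + η) + spectralForm T f (ψ - η) =
      2 * spectralForm T f ψ + 2 * spectralForm T f η := by
    simp only [spectralForm, map_add, map_sub, inner_add_left, inner_add_right, inner_sub_left,
      inner_sub_right, Complex.add_re, Complex.sub_re]
    ring
  linarith [spectralForm_nonneg T hf (ψ - η)]

/-- The vectors on which the forms of a sequence of functions with values in `[0, 1]` tend to zero
constitute a closed subspace. -/
def vanishingSubspace (T : E →L[ℂ] E) (f : ℕ → ℝ → ℝ) (hf : ∀ n x, 0 ≤ f n x) :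
    Submodule ℂ E where
  carrier := {ψ | Tendsto (fun n => spectralForm T (f n) ψ) atTop (𝓝 0)}
  zero_mem' := by simp [spectralForm]
  add_mem' {ψ η} hψ hη := by
    refine squeeze_zero (fun n => spectralForm_nonneg T (hf n) _)
      (fun n => spectralForm_add_le T (hf n) ψ η) ?_
    simpa using (Tendsto.const_mul 2 hψ).add (Tendsto.const_mul 2 hη)
  smul_mem' c ψ hψ := by
    simpa [spectralForm_smul] using Tendsto.const_mul (‖c‖ ^ 2) hψ

/-- The forms are bounded by `‖ψ‖ ^ 2` uniformly in `n`, so an approximating vector controls the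
limit. -/
theorem isClosed_vanishingSubspace (T : E →L[ℂ] E) (f : ℕ → ℝ → ℝ) (hf : ∀ n x, 0 ≤ f n x)
    (hf₁ : ∀ n x, f n x ≤ 1) : IsClosed (vanishingSubspace T f hf : Set E) := by
  refine isClosed_of_closure_subset fun ψ hψ => ?_
  change Tendsto (fun n => spectralForm T (f n) ψ) atTop (𝓝 0)
  rw [Metric.tendsto_atTop]
  intro ε hε
  -- The form at `ψ - η` is at most `‖ψ - η‖ ^ 2 < ε / 4`; `spectralForm_add_le` doubles this and
  -- the `ε / 4` at `η`.
  obtain ⟨η, hη, hd⟩ := Metric.mem_closure_iff.1 hψ (√(ε / 4)) (by positivity)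
  have hη' : Tendsto (fun n => spectralForm T (f n) η) atTop (𝓝 0) := hη
  obtain ⟨N, hN⟩ := Metric.tendsto_atTop.1 hη' (ε / 4) (by positivity)
  refine ⟨N, fun n hn => ?_⟩
  have h1 := hN n hn
  have h2 := spectralForm_add_le T (hf n) η (ψ - η)
  have h3 := spectralForm_le T (f := f n)
    (fun x => by rw [abs_of_nonneg (hf n x)]; exact hf₁ n x) (ψ - η)
  have h4 : ‖ψ - η‖ ^ 2 < ε / 4 := by
    rw [dist_eq_norm] at hd
    exact (Real.lt_sqrt (norm_nonneg _)).1 hd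
  rw [Real.dist_eq, sub_zero, abs_of_nonneg (spectralForm_nonneg T (hf n) _)] at h1 ⊢
  rw [add_sub_cancel] at h2
  linarith

/-- The tent functions `max 0 (1 - (n + 1) dist(x, K))`, decreasing to the indicator of `K`. -/
def tent (K : Set ℝ) (n : ℕ) (x : ℝ) : ℝ := max 0 (1 - (n + 1) * Metric.infDist x K)

theorem tent_nonneg (K : Set ℝ) (n : ℕ) (x : ℝ) : 0 ≤ tent K n x := le_max_left _ _

theorem tent_le_one (K : Set ℝ) (n : ℕ) (x : ℝ) : tent K n x ≤ 1 :=
  max_le zero_le_one (sub_le_self _ (by have := Metric.infDist_nonneg (x := x) (s := K); positivity))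

theorem abs_tent_le_one (K : Set ℝ) (n : ℕ) (x : ℝ) : |tent K n x| ≤ 1 := by
  rw [abs_of_nonneg (tent_nonneg K n x)]; exact tent_le_one K n x

theorem continuous_tent (K : Set ℝ) (n : ℕ) : Continuous (tent K n) := by
  have := Metric.continuous_infDist_pt K
  unfold tent
  fun_prop

theorem tent_of_mem {K : Set ℝ} (n : ℕ) {x : ℝ} (hx : x ∈ K) : tent K n x = 1 := by
  simp [tent, Metric.infDist_zero_of_mem hx]

theorem eventually_tent_eq_zero {K : Set ℝ} {δ : ℝ} (hδ : 0 < δ) :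
    ∀ᶠ n in atTop, ∀ x, δ ≤ Metric.infDist x K → tent K n x = 0 := by
  obtain ⟨N, hN⟩ := exists_nat_gt (1 / δ)
  filter_upwards [eventually_ge_atTop N] with n hn x hx
  refine max_eq_left ?_
  have h1 : (N : ℝ) ≤ n := by exact_mod_cast hn
  have h2 : 1 < N * δ := by rwa [div_lt_iff₀ hδ] at hN
  have : (N : ℝ) * δ ≤ (n + 1) * Metric.infDist x K := by gcongr; linarith
  linarith

theorem hasCompactSupport_tent {K : Set ℝ} (hK : IsCompact K) (hne : K.Nonempty) (n : ℕ) :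
    HasCompactSupport (tent K n) := by
  refine HasCompactSupport.intro (K := Metric.cthickening 1 K) hK.cthickening fun x hx => ?_
  rw [hK.cthickening_eq_biUnion_closedBall zero_le_one] at hx
  obtain ⟨y, hy, hxy⟩ := hK.exists_infDist_eq_dist hne x
  simp only [Set.mem_iUnion, Metric.mem_closedBall, not_exists, not_le] at hx
  refine max_eq_left ?_
  have := hx y hy
  rw [← hxy] at this
  nlinarith [Nat.cast_nonneg (α := ℝ) n]

instance isRegular_spectralMeasure (T : E →L[ℂ] E) (ψ : E) : (spectralMeasure T ψ).Regular :=
  RealRMK.regular_rieszMeasure _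

theorem spectralMeasure_le_spectralForm_tent (T : E →L[ℂ] E) (ψ : E) {K : Set ℝ}
    (hK : IsCompact K) (n : ℕ) :
    spectralMeasure T ψ K ≤ ENNReal.ofReal (spectralForm T (tent K n) ψ) := by
  -- The distance to `∅` is `0` by convention, so `tent ∅ n` is constantly `1` and not compactly
  -- supported.
  rcases K.eq_empty_or_nonempty with rfl | hne
  · simp
  exact RealRMK.rieszMeasure_le_of_eq_one (spectralFunctional T ψ)
    (f := ⟨⟨tent K n, continuous_tent K n⟩, hasCompactSupport_tent hK hne n⟩)
    (fun x => tent_nonneg K n x) hK (fun x hx => tent_of_mem n hx)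

instance isFiniteMeasure_spectralMeasure (T : E →L[ℂ] E) (ψ : E) :
    IsFiniteMeasure (spectralMeasure T ψ) := by
  refine ⟨lt_of_le_of_lt ?_ (ENNReal.ofReal_lt_top (r := ‖ψ‖ ^ 2))⟩
  rw [isOpen_univ.measure_eq_iSup_isCompact]
  refine iSup_le fun K => iSup_le fun _ => iSup_le fun hK => ?_
  exact (spectralMeasure_le_spectralForm_tent T ψ hK 0).trans
    (ENNReal.ofReal_le_ofReal (spectralForm_le T (abs_tent_le_one K 0) ψ))

/-- Inner regularity reduces null sets to compact null sets, where tents bound the measure from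
above. -/
theorem spectralMeasure_absolutelyContinuous (T : E →L[ℂ] E) (ψ : E)
    (h : ∀ K : Set ℝ, IsCompact K → K.Nonempty → volume K = 0 →
      Tendsto (fun n => spectralForm T (tent K n) ψ) atTop (𝓝 0)) :
    spectralMeasure T ψ ≪ volume := by
  refine Measure.AbsolutelyContinuous.mk fun s hs hs0 => ?_
  rw [hs.measure_eq_iSup_isCompact_of_ne_top (measure_ne_top _ _)]
  simp only [ENNReal.iSup_eq_zero]
  intro K hKs hK
  rcases K.eq_empty_or_nonempty with rfl | hne
  · exact measure_empty
  have h1 := ENNReal.tendsto_ofReal (h K hK hne (measure_mono_null hKs hs0))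
  rw [ENNReal.ofReal_zero] at h1
  exact le_antisymm (ge_of_tendsto' h1 fun n => spectralMeasure_le_spectralForm_tent T ψ hK n)
    zero_le

/-- Two vectors whose forms agree on continuous functions have the same spectral measure. -/
theorem spectralMeasure_congr (T : E →L[ℂ] E) {ψ η : E}
    (h : ∀ f : ℝ → ℝ, Continuous f → spectralForm T f ψ = spectralForm T f η) :
    spectralMeasure T ψ = spectralMeasure T η := by
  have : spectralFunctional T ψ = spectralFunctional T η := by
    ext f
    exact h f f.continuous
  rw [spectralMeasure, this, spectralMeasure]

theorem integral_spectralMeasure_eq_spectralForm (T : E →L[ℂ] E) (ψ : E) {f : ℝ → ℝ}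
    (hf : Continuous f) (hf' : HasCompactSupport f) :
    ∫ x, f x ∂(spectralMeasure T ψ) = spectralForm T f ψ :=
  integral_spectralMeasure T ψ ⟨⟨f, hf⟩, hf'⟩

/-- Diagonal entries of `f(T)` are real. -/
theorem inner_functionalCalculus_self (T : E →L[ℂ] E) (f : ℝ → ℝ) (ψ : E) :
    ⟪ψ, functionalCalculus T f ψ⟫_ℂ = (spectralForm T f ψ : ℂ) := by
  have h : IsSelfAdjoint (functionalCalculus T f) := cfc_predicate f T
  refine (Complex.conj_eq_iff_re.1 ?_).symm
  rw [inner_conj_symm]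
  exact (ContinuousLinearMap.isSelfAdjoint_iff_isSymmetric.1 h) ψ ψ

end SpectralTheory

/-! ### Zero sets of real analytic functions of two variables. -/

/-- The derivative in the first variable. -/
def partialFst (F : ℝ × ℝ → ℂ) (p : ℝ × ℝ) : ℂ := fderiv ℝ F p (1, 0)

theorem contDiff_partialFst {F : ℝ × ℝ → ℂ} (hF : ContDiff ℝ ω F) : ContDiff ℝ ω (partialFst F) :=
  (hF.fderiv_right (m := ω) (by simp)).clm_apply contDiff_const

theorem contDiff_iterate_partialFst {F : ℝ × ℝ → ℂ} (hF : ContDiff ℝ ω F) (n : ℕ) :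
    ContDiff ℝ ω (partialFst^[n] F) := by
  induction n with
  | zero => exact hF
  | succ n ih => rw [Function.iterate_succ_apply']; exact contDiff_partialFst ih

theorem iteratedDeriv_eq_iterate_partialFst {F : ℝ × ℝ → ℂ} (hF : ContDiff ℝ ω F) (n : ℕ)
    (k e : ℝ) : iteratedDeriv n (fun x => F (x, e)) k = (partialFst^[n] F) (k, e) := by
  induction n generalizing k with
  | zero => simp
  | succ n ih =>
    rw [iteratedDeriv_succ, Function.iterate_succ_apply', funext ih]
    have h1 : HasFDerivAt (partialFst^[n] F) (fderiv ℝ (partialFst^[n] F) (k, e)) (k, e) :=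
      (((contDiff_iterate_partialFst hF n).differentiable (by simp)) _).hasFDerivAt
    have h2 : HasDerivAt (fun x : ℝ => (x, e)) (1, 0) k :=
      (hasDerivAt_id k).prodMk (hasDerivAt_const k e)
    exact (h1.comp_hasDerivAt k h2).deriv

/-- Near a zero with nonvanishing first partial derivative, the projection to the first axis of the
zero set over a null set is null. -/
theorem exists_nhds_volume_eq_zero_of_simple_zero {G : ℝ × ℝ → ℂ} (hG : ContDiff ℝ ω G)
    {p : ℝ × ℝ} (hp : partialFst G p ≠ 0) {N : Set ℝ} (hN : volume N = 0) :
    ∃ V ∈ 𝓝 p, volume (Prod.fst '' {x ∈ V | x.2 ∈ N ∧ G x = 0}) = 0 := by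
  have hs : HasStrictFDerivAt G (fderiv ℝ G p) p :=
    hG.contDiffAt.hasStrictFDerivAt (by simp)
  set a := ‖partialFst G p‖ with ha
  have ha0 : 0 < a := norm_pos_iff.2 hp
  set b := ‖fderiv ℝ G p (0, 1)‖ with hb
  have hb0 : 0 ≤ b := norm_nonneg _
  obtain ⟨V, hV, hVs⟩ := (hs.isLittleO.def (half_pos ha0)).exists_mem
  rw [nhds_prod_eq] at hV
  obtain ⟨W, hW, hWV⟩ : ∃ W ∈ 𝓝 p, W ×ˢ W ⊆ V := Filter.mem_prod_same_iff.1 hV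
  refine ⟨W, hW, ?_⟩
  set S := {x ∈ W | x.2 ∈ N ∧ G x = 0} with hS
  -- Between two zeros the increment of `G` is `0`, so `a|Δ₁| - b|Δ₂| ≤ (a/2)(|Δ₁| + |Δ₂|)`; half of
  -- `a|Δ₁|` is absorbed on the left. No implicit function is needed, and the values of `G` may be
  -- complex.
  have key : ∀ x ∈ S, ∀ y ∈ S, |x.1 - y.1| ≤ (2 * b / a + 1) * |x.2 - y.2| := by
    rintro x ⟨hxW, -, hx⟩ y ⟨hyW, -, hy⟩
    have h1 := hVs (x, y) (hWV ⟨hxW, hyW⟩)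
    simp only [hx, hy, sub_zero, zero_sub, norm_neg] at h1
    have h2 : x - y = (x.1 - y.1) • (1, 0) + (x.2 - y.2) • ((0, 1) : ℝ × ℝ) := by
      ext <;> simp
    have h3 : ‖x - y‖ ≤ |x.1 - y.1| + |x.2 - y.2| := by
      rw [Prod.norm_def]
      exact max_le (le_add_of_nonneg_right (abs_nonneg _)) (le_add_of_nonneg_left (abs_nonneg _))
    have h4 : |x.1 - y.1| * a - |x.2 - y.2| * b ≤ ‖fderiv ℝ G p (x - y)‖ := by
      rw [h2, map_add, map_smul, map_smul]
      have := norm_sub_norm_le ((x.1 - y.1) • fderiv ℝ G p (1, 0))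
        (-((x.2 - y.2) • fderiv ℝ G p (0, 1)))
      rw [norm_neg, norm_smul, norm_smul, sub_neg_eq_add] at this
      exact this
    have h5 : |x.1 - y.1| * a ≤ (2 * b + a) * |x.2 - y.2| := by nlinarith
    have h6 : (2 * b / a + 1) * |x.2 - y.2| = ((2 * b + a) * |x.2 - y.2|) / a := by
      field_simp
    rw [h6, le_div_iff₀ ha0]
    exact h5
  have hinj : Set.InjOn Prod.snd S := by
    intro x hx y hy hxy
    have := key x hx y hy
    rw [hxy, sub_self, abs_zero, mul_zero] at this
    exact Prod.ext (sub_eq_zero.1 (abs_nonpos_iff.1 this)) hxy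
  -- `S` is the graph of `g` over its second coordinates, with the Lipschitz constant from `key`.
  set g : ℝ → ℝ := fun e => (Function.invFunOn Prod.snd S e).1 with hg
  have hgS : ∀ x ∈ S, g x.2 = x.1 := fun x hx => by
    rw [hg]; exact congrArg Prod.fst (hinj.leftInvOn_invFunOn hx)
  have hLip : LipschitzOnWith (2 * b / a + 1).toNNReal g (Prod.snd '' S) := by
    refine LipschitzOnWith.of_dist_le_mul ?_
    rintro _ ⟨x, hx, rfl⟩ _ ⟨y, hy, rfl⟩
    rw [hgS x hx, hgS y hy, Real.dist_eq, Real.dist_eq, Real.coe_toNNReal _ (by positivity)]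
    exact key x hx y hy
  have himg : Prod.fst '' S ⊆ g '' (Prod.snd '' S) := by
    rintro _ ⟨x, hx, rfl⟩
    exact ⟨x.2, ⟨x, hx, rfl⟩, hgS x hx⟩
  have h0 : volume (Prod.snd '' S) = 0 := measure_mono_null (by rintro _ ⟨x, hx, rfl⟩; exact hx.2.1) hN
  refine measure_mono_null himg (le_antisymm ?_ zero_le)
  -- Lebesgue measure as one-dimensional Hausdorff measure, which a Lipschitz map scales by at most
  -- a constant.
  rw [← hausdorffMeasure_real] at h0 ⊢
  refine (hLip.hausdorffMeasure_image_le (d := 1) zero_le_one).trans_eq ?_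
  rw [h0, mul_zero]

/-- The plane is second countable, so countably many of the local neighbourhoods cover all points
with nonzero partial derivative. -/
theorem volume_fst_simple_zeros_eq_zero {G : ℝ × ℝ → ℂ} (hG : ContDiff ℝ ω G) {N : Set ℝ}
    (hN : volume N = 0) :
    volume {k : ℝ | ∃ e ∈ N, G (k, e) = 0 ∧ partialFst G (k, e) ≠ 0} = 0 := by
  choose! V hV hV0 using fun p (hp : partialFst G p ≠ 0) =>
    exists_nhds_volume_eq_zero_of_simple_zero hG hp hN
  obtain ⟨t, htsub, htc, hcov⟩ := TopologicalSpace.countable_cover_nhdsWithin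
    (s := {p | partialFst G p ≠ 0}) (f := V) (fun p hp => mem_nhdsWithin_of_mem_nhds (hV p hp))
  refine measure_mono_null (t := ⋃ p ∈ t, Prod.fst '' {x ∈ V p | x.2 ∈ N ∧ G x = 0}) ?_
    ((measure_biUnion_null_iff htc).2 fun p hp => hV0 p (htsub hp))
  rintro k ⟨e, he, h0, h1⟩
  obtain ⟨p, hp, hpV⟩ := Set.mem_iUnion₂.1 (hcov h1)
  exact Set.mem_iUnion₂.2 ⟨p, hp, (k, e), ⟨hpV, he, h0⟩, rfl⟩

/-- If `F` is real analytic and no `F(·, e)` vanishes on an open set, then the zeros of `F` over a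
null set of second coordinates have a null projection to the first axis. -/
theorem volume_fst_zeros_eq_zero {F : ℝ × ℝ → ℂ} (hF : ContDiff ℝ ω F)
    (hne : ∀ k e : ℝ, ¬ ∀ᶠ x in 𝓝 k, F (x, e) = 0) {N : Set ℝ} (hN : volume N = 0) :
    volume {k : ℝ | ∃ e ∈ N, F (k, e) = 0} = 0 := by
  refine measure_mono_null (t := ⋃ n : ℕ, {k : ℝ | ∃ e ∈ N, (partialFst^[n] F) (k, e) = 0 ∧
    partialFst (partialFst^[n] F) (k, e) ≠ 0}) ?_
    (measure_iUnion_null fun n =>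
      volume_fst_simple_zeros_eq_zero (contDiff_iterate_partialFst hF n) hN)
  rintro k ⟨e, he, h0⟩
  have hex : ∃ n, (partialFst^[n] F) (k, e) ≠ 0 := by
    -- If all `k`-derivatives vanish at the point, analyticity forces `F(·, e)` to vanish near `k`,
    -- against `hne`.
    by_contra! hall
    have han : AnalyticAt ℝ (fun x => F (x, e)) k :=
      (hF.comp (contDiff_id.prodMk contDiff_const)).contDiffAt.analyticAt
    refine hne k e (analyticOrderAt_eq_top.1 ?_)
    rw [ENat.eq_top_iff_forall_ge]
    intro m
    rw [natCast_le_analyticOrderAt_iff_iteratedDeriv_eq_zero han]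
    intro i _
    rw [iteratedDeriv_eq_iterate_partialFst hF, hall i]
  classical
  -- The first nonvanishing derivative has positive order because `F (k, e) = 0`; the derivative
  -- just before it has a simple zero.
  obtain ⟨n, hn⟩ : ∃ n, Nat.find hex = n + 1 := by
    refine Nat.exists_eq_succ_of_ne_zero fun h => ?_
    have := Nat.find_spec hex
    rw [h] at this
    exact this h0
  refine Set.mem_iUnion.2 ⟨n, e, he, ?_, ?_⟩
  · by_contra h
    exact Nat.find_min hex (m := n) (by omega) h
  · have := Nat.find_spec hex
    rwa [hn, Function.iterate_succ_apply'] at this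

/-! ### Phases and their orthogonality. -/

/-- The phase `exp(2πik)`. -/
def phase (k : ℝ) : ℂ := Complex.exp (2 * Real.pi * Complex.I * k)

theorem phase_zero : phase 0 = 1 := by simp [phase]

theorem phase_add (k l : ℝ) : phase (k + l) = phase k * phase l := by
  rw [phase, phase, phase, ← Complex.exp_add]; push_cast; ring_nf

theorem phase_ne_zero (k : ℝ) : phase k ≠ 0 := Complex.exp_ne_zero _

theorem conj_phase (k : ℝ) : (starRingEnd ℂ) (phase k) = phase (-k) := by
  rw [phase, phase, ← Complex.exp_conj]
  simp [Complex.conj_ofNat]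

theorem contDiff_phase : ContDiff ℝ ω phase := by
  unfold phase
  exact (contDiff_const.mul Complex.ofRealCLM.contDiff).cexp

theorem continuous_phase : Continuous phase := contDiff_phase.continuous

theorem integral_phase_intCast_mul (m : ℤ) :
    ∫ k in (0 : ℝ)..1, phase (m * k) = if m = 0 then 1 else 0 := by
  split_ifs with hm
  · simp [hm, phase_zero]
  · have hc : (2 * Real.pi * Complex.I * m : ℂ) ≠ 0 := by
      simp [Real.pi_ne_zero, hm]
    have h : ∀ k : ℝ, phase (m * k) = Complex.exp (2 * Real.pi * Complex.I * m * k) := fun k => by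
      rw [phase]; push_cast; ring_nf
    simp_rw [h]
    rw [integral_exp_mul_complex hc]
    have : Complex.exp (2 * Real.pi * Complex.I * m * (1 : ℝ)) = 1 := by
      rw [Complex.exp_eq_one_iff]
      exact ⟨m, by push_cast; ring⟩
    rw [this]; simp

/-- Multiplication of the argument by a positive integer takes a phase in a given finite set only at
countably many points. -/
theorem countable_phase_mem {T : Set ℂ} (hT : T.Countable) {q : ℕ} (hq : q ≠ 0) :
    {x : ℝ | phase (q * x) ∈ T}.Countable := by
  have h : Function.Injective fun x : ℝ => (2 * Real.pi * Complex.I * ((q * x : ℝ) : ℂ)) := by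
    intro x y hxy
    have h1 : (2 * Real.pi * Complex.I : ℂ) ≠ 0 := by simp [Real.pi_ne_zero]
    have h2 := Complex.ofReal_injective (mul_left_cancel₀ h1 hxy)
    exact mul_left_cancel₀ (by exact_mod_cast hq) h2
  exact hT.preimage_cexp.preimage h

/-! ### Bloch matrices, monodromy and the absence of flat bands. -/

namespace DiracHarper

variable {q : ℕ}

/-- Solutions of `t v_{n+1} + t v_{n-1} + B_n v_n = e v_n` with a `q`-periodic potential. -/
def solutions (t : Matrix (Fin 4) (Fin 4) ℂ) (B : ZMod q → Matrix (Fin 4) (Fin 4) ℂ) (e : ℂ) :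
    Submodule ℂ (ℤ → Fin 4 → ℂ) where
  carrier := {v | ∀ n : ℤ, t *ᵥ v (n + 1) + t *ᵥ v (n - 1) + B n *ᵥ v n = e • v n}
  zero_mem' n := by simp
  add_mem' {v w} hv hw n := by
    have h1 := hv n
    have h2 := hw n
    simp only [Pi.add_apply, Matrix.mulVec_add, smul_add, ← h1, ← h2]
    abel
  smul_mem' c v hv n := by
    simp only [Pi.smul_apply, Matrix.mulVec_smul, smul_comm e c, ← hv n, smul_add]

/-- Invertibility of `t` lets the three-term recursion be solved both forwards and backwards from
two adjacent sites. -/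
theorem eq_zero_of_mem_solutions {t : Matrix (Fin 4) (Fin 4) ℂ} (ht : IsUnit t)
    {B : ZMod q → Matrix (Fin 4) (Fin 4) ℂ} {e : ℂ} {v : ℤ → Fin 4 → ℂ}
    (hv : v ∈ solutions t B e) (h0 : v 0 = 0) (h1 : v 1 = 0) : v = 0 := by
  have hinj : ∀ x, t *ᵥ x = 0 → x = 0 := fun x hx =>
    Matrix.mulVec_injective_iff_isUnit.2 ht (by rw [hx, Matrix.mulVec_zero])
  have hup : ∀ n : ℕ, v n = 0 ∧ v (n + 1) = 0 := by
    intro n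
    induction n with
    | zero => simpa using ⟨h0, h1⟩
    | succ n ih =>
      refine ⟨by simpa using ih.2, ?_⟩
      have := hv (n + 1)
      rw [add_sub_cancel_right, ih.1, ih.2] at this
      simpa using hinj _ (by simpa using this)
  have hdown : ∀ n : ℕ, v (-n) = 0 ∧ v (-n + 1) = 0 := by
    intro n
    induction n with
    | zero => simpa using ⟨h0, h1⟩
    | succ n ih =>
      have e1 : (-((n + 1 : ℕ) : ℤ)) = -n - 1 := by push_cast; ring
      rw [e1, sub_add_cancel]
      refine ⟨?_, ih.1⟩
      have := hv (-n)
      rw [ih.1, ih.2] at this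
      exact hinj _ (by simpa using this)
  funext n
  obtain ⟨m, rfl | rfl⟩ := n.eq_nat_or_neg
  · exact (hup m).1
  · exact (hdown m).1

theorem finite_solutions {t : Matrix (Fin 4) (Fin 4) ℂ} (ht : IsUnit t)
    (B : ZMod q → Matrix (Fin 4) (Fin 4) ℂ) (e : ℂ) : Module.Finite ℂ (solutions t B e) := by
  let init : solutions t B e →ₗ[ℂ] (Fin 4 → ℂ) × (Fin 4 → ℂ) :=
    ((LinearMap.proj (R := ℂ) (φ := fun _ : ℤ => Fin 4 → ℂ) 0).prod (LinearMap.proj 1)).comp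
      (solutions t B e).subtype
  refine Module.Finite.of_injective init ((injective_iff_map_eq_zero init).2 fun v hv => ?_)
  exact Subtype.ext (eq_zero_of_mem_solutions ht v.2 (congrArg Prod.fst hv) (congrArg Prod.snd hv))

/-- The translation by one period on the space of solutions. -/
def monodromy (t : Matrix (Fin 4) (Fin 4) ℂ) (B : ZMod q → Matrix (Fin 4) (Fin 4) ℂ) (e : ℂ) :
    Module.End ℂ (solutions t B e) where
  toFun v := ⟨fun n => v.1 (n + q), fun n => by
    have := v.2 (n + q)
    simpa [add_right_comm n 1 (q : ℤ), sub_add_eq_add_sub] using this⟩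
  map_add' _ _ := rfl
  map_smul' _ _ := rfl

theorem finite_monodromy_hasEigenvalue {t : Matrix (Fin 4) (Fin 4) ℂ} (ht : IsUnit t)
    (B : ZMod q → Matrix (Fin 4) (Fin 4) ℂ) (e : ℂ) :
    {ζ | (monodromy t B e).HasEigenvalue ζ}.Finite := by
  have := finite_solutions ht B e
  exact (monodromy t B e).finite_hasEigenvalue

/-- The Bloch matrix: the action of the periodic operator on `n ↦ exp(2πikn) u_{n mod q}`. -/
def blochMatrix (t : Matrix (Fin 4) (Fin 4) ℂ) (B : ZMod q → Matrix (Fin 4) (Fin 4) ℂ) (k : ℝ) :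
    Matrix (ZMod q × Fin 4) (ZMod q × Fin 4) ℂ :=
  -- The three conditions are summed, not nested: for `q ≤ 2` neighbouring residues coincide and
  -- their contributions must add.
  Matrix.of fun a b => (if b.1 = a.1 + 1 then phase k * t a.2 b.2 else 0) +
    (if b.1 = a.1 - 1 then phase (-k) * t a.2 b.2 else 0) +
    (if b.1 = a.1 then B a.1 a.2 b.2 else 0)

theorem isHermitian_blochMatrix {t : Matrix (Fin 4) (Fin 4) ℂ} (ht : t.IsHermitian)
    {B : ZMod q → Matrix (Fin 4) (Fin 4) ℂ} (hB : ∀ r, (B r).IsHermitian) (k : ℝ) :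
    (blochMatrix t B k).IsHermitian := by
  refine Matrix.IsHermitian.ext fun a b => ?_
  have h1 : a.1 = b.1 + 1 ↔ b.1 = a.1 - 1 := by rw [eq_sub_iff_add_eq, eq_comm]
  have h2 : a.1 = b.1 - 1 ↔ b.1 = a.1 + 1 := by rw [eq_sub_iff_add_eq, eq_comm]
  have h3 : a.1 = b.1 ↔ b.1 = a.1 := eq_comm
  have ht' : (starRingEnd ℂ) (t b.2 a.2) = t a.2 b.2 := ht.apply _ _
  simp only [blochMatrix, Matrix.of_apply, star_add, h1, h2, h3, RCLike.star_def]
  -- Taking adjoints exchanges the forward and backward hopping terms.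
  rw [add_comm (starRingEnd ℂ (if b.1 = a.1 - 1 then _ else _))]
  simp only [apply_ite (starRingEnd ℂ), map_mul, map_zero, conj_phase, neg_neg, ht']
  congr 1
  split_ifs with h
  · rw [h]; exact (hB a.1).apply _ _
  · rfl

theorem blochMatrix_mulVec [NeZero q] (t : Matrix (Fin 4) (Fin 4) ℂ) (B : ZMod q → Matrix (Fin 4) (Fin 4) ℂ)
    (k : ℝ) (u : ZMod q × Fin 4 → ℂ) (r : ZMod q) (i : Fin 4) :
    (blochMatrix t B k *ᵥ u) (r, i) = phase k * ∑ j, t i j * u (r + 1, j) +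
      phase (-k) * ∑ j, t i j * u (r - 1, j) + ∑ j, B r i j * u (r, j) := by
  simp only [Matrix.mulVec, dotProduct, blochMatrix, Matrix.of_apply, Fintype.sum_prod_type_right,
    add_mul, ite_mul, zero_mul, Finset.sum_add_distrib, Finset.sum_ite_eq', Finset.mem_univ,
    if_true, Finset.mul_sum, mul_assoc]

/-- The characteristic function `det(e - A(k))` of the Bloch matrices. -/
def dispersion [NeZero q] (t : Matrix (Fin 4) (Fin 4) ℂ) (B : ZMod q → Matrix (Fin 4) (Fin 4) ℂ)
    (p : ℝ × ℝ) : ℂ :=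
  ((p.2 : ℂ) • (1 : Matrix (ZMod q × Fin 4) (ZMod q × Fin 4) ℂ) - blochMatrix t B p.1).det

theorem contDiff_blochMatrix_apply (t : Matrix (Fin 4) (Fin 4) ℂ)
    (B : ZMod q → Matrix (Fin 4) (Fin 4) ℂ) (a b : ZMod q × Fin 4) :
    ContDiff ℝ ω fun k => blochMatrix t B k a b := by
  have h1 : ContDiff ℝ ω phase := contDiff_phase
  have h2 : ContDiff ℝ ω fun k => phase (-k) := contDiff_phase.comp contDiff_neg
  simp only [blochMatrix, Matrix.of_apply]
  refine (ContDiff.add ?_ ?_).add contDiff_const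
  · split_ifs
    · exact h1.mul contDiff_const
    · exact contDiff_const
  · split_ifs
    · exact h2.mul contDiff_const
    · exact contDiff_const

theorem contDiff_dispersion [NeZero q] (t : Matrix (Fin 4) (Fin 4) ℂ)
    (B : ZMod q → Matrix (Fin 4) (Fin 4) ℂ) : ContDiff ℝ ω (dispersion t B) := by
  unfold dispersion
  simp only [Matrix.det_apply]
  refine ContDiff.sum fun σ _ => ContDiff.const_smul _ (contDiff_prod fun a _ => ?_)
  simp only [Matrix.sub_apply, Matrix.smul_apply]
  exact ((Complex.ofRealCLM.contDiff.comp contDiff_snd).smul contDiff_const).sub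
    ((contDiff_blochMatrix_apply t B _ _).comp contDiff_fst)

/-- A kernel vector `u` yields the Bloch wave `n ↦ phase (n * k) * u (n mod q)`, a solution that one
period multiplies by `phase (q * k)`. -/
theorem hasEigenvalue_monodromy_of_dispersion_eq_zero [NeZero q] {t : Matrix (Fin 4) (Fin 4) ℂ}
    {B : ZMod q → Matrix (Fin 4) (Fin 4) ℂ} {k e : ℝ} (h : dispersion t B (k, e) = 0) :
    (monodromy t B e).HasEigenvalue (phase (q * k)) := by
  obtain ⟨u, hu0, hu⟩ := Matrix.exists_mulVec_eq_zero_iff.2 h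
  rw [Matrix.sub_mulVec, Matrix.smul_mulVec, Matrix.one_mulVec, sub_eq_zero] at hu
  have hv : (fun (n : ℤ) j => phase (n * k) * u (n, j)) ∈ solutions t B e := by
    intro n
    funext i
    have h1 := congrFun hu ((n : ZMod q), i)
    have e1 : phase ((n + 1) * k) = phase (n * k) * phase k := by
      rw [← phase_add]; ring_nf
    have e2 : phase ((n - 1) * k) = phase (n * k) * phase (-k) := by
      rw [← phase_add]; ring_nf
    rw [blochMatrix_mulVec] at h1
    simp only [Pi.add_apply, Pi.smul_apply, Matrix.mulVec, dotProduct, smul_eq_mul, e1, e2,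
      Int.cast_add, Int.cast_sub, Int.cast_one] at h1 ⊢
    rw [mul_left_comm, h1]
    simp only [mul_add, Finset.mul_sum]
    congr 1
    · congr 1 <;> exact Finset.sum_congr rfl fun j _ => by ring
    · exact Finset.sum_congr rfl fun j _ => by ring
  refine Module.End.hasEigenvalue_of_hasEigenvector (x := ⟨_, hv⟩)
    ⟨Module.End.mem_eigenspace_iff.2 (Subtype.ext ?_), fun h0 => hu0 ?_⟩
  · funext n j
    change phase ((n + q : ℤ) * k) * u ((n + q : ℤ), j) = phase (q * k) * (phase (n * k) * u (n, j))
    have : phase ((n + q : ℤ) * k) = phase (q * k) * phase (n * k) := by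
      rw [← phase_add]; push_cast; ring_nf
    rw [this, mul_assoc]
    simp
  · funext ⟨r, j⟩
    have h1 := congrFun (congrFun (congrArg Subtype.val h0) (r.val : ℤ)) j
    have h2 : phase ((r.val : ℤ) * k) * u (((r.val : ℤ) : ZMod q), j) = 0 := h1
    simpa [phase_ne_zero] using h2

/-- No flat bands: at fixed `e` the zeros `k` have `phase (q * k)` in a finite set, hence are
countable and contain no open interval. -/
theorem not_eventually_dispersion_eq_zero [NeZero q] {t : Matrix (Fin 4) (Fin 4) ℂ} (ht : IsUnit t)
    (B : ZMod q → Matrix (Fin 4) (Fin 4) ℂ) (k e : ℝ) :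
    ¬ ∀ᶠ x in 𝓝 k, dispersion t B (x, e) = 0 := by
  intro h
  have hc := countable_phase_mem (finite_monodromy_hasEigenvalue ht B e).countable (NeZero.ne q)
  have hmem : k ∈ interior {x : ℝ | phase (q * x) ∈ {ζ | (monodromy t B e).HasEigenvalue ζ}} :=
    mem_interior_iff_mem_nhds.2 (h.mono fun x hx => hasEigenvalue_monodromy_of_dispersion_eq_zero hx)
  rw [interior_eq_empty_iff_dense_compl.2 (hc.dense_compl ℝ)] at hmem
  exact hmem

theorem volume_exists_dispersion_eq_zero [NeZero q] {t : Matrix (Fin 4) (Fin 4) ℂ} (ht : IsUnit t)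
    (B : ZMod q → Matrix (Fin 4) (Fin 4) ℂ) {N : Set ℝ} (hN : volume N = 0) :
    volume {k : ℝ | ∃ e ∈ N, dispersion t B (k, e) = 0} = 0 :=
  volume_fst_zeros_eq_zero (contDiff_dispersion t B) (not_eventually_dispersion_eq_zero ht B) hN

/-- The Bloch matrix as an operator on a Hilbert space. -/
def blochOperator [NeZero q] (t : Matrix (Fin 4) (Fin 4) ℂ) (B : ZMod q → Matrix (Fin 4) (Fin 4) ℂ) (k : ℝ) :
    EuclideanSpace ℂ (ZMod q × Fin 4) →L[ℂ] EuclideanSpace ℂ (ZMod q × Fin 4) :=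
  Matrix.toEuclideanCLM (𝕜 := ℂ) (blochMatrix t B k)

theorem blochOperator_apply [NeZero q] (t : Matrix (Fin 4) (Fin 4) ℂ) (B : ZMod q → Matrix (Fin 4) (Fin 4) ℂ)
    (k : ℝ) (u : EuclideanSpace ℂ (ZMod q × Fin 4)) (r : ZMod q) (i : Fin 4) :
    blochOperator t B k u (r, i) = phase k * ∑ j, t i j * u (r + 1, j) +
      phase (-k) * ∑ j, t i j * u (r - 1, j) + ∑ j, B r i j * u (r, j) :=
  blochMatrix_mulVec t B k u r i

theorem isSelfAdjoint_blochOperator [NeZero q] {t : Matrix (Fin 4) (Fin 4) ℂ} (ht : t.IsHermitian)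
    {B : ZMod q → Matrix (Fin 4) (Fin 4) ℂ} (hB : ∀ r, (B r).IsHermitian) (k : ℝ) :
    IsSelfAdjoint (blochOperator t B k) :=
  IsSelfAdjoint.map (isHermitian_blochMatrix ht hB k).isSelfAdjoint
    (Matrix.toEuclideanCLM (𝕜 := ℂ) (n := ZMod q × Fin 4))

theorem continuous_blochOperator [NeZero q] (t : Matrix (Fin 4) (Fin 4) ℂ)
    (B : ZMod q → Matrix (Fin 4) (Fin 4) ℂ) : Continuous (blochOperator t B) := by
  have h : Continuous (blochMatrix t B) :=
    continuous_matrix fun a b => (contDiff_blochMatrix_apply t B a b).continuous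
  exact (LinearMap.continuous_of_finiteDimensional
    (Matrix.toEuclideanCLM (𝕜 := ℂ) (n := ZMod q × Fin 4)).toAlgEquiv.toLinearMap).comp h

theorem dispersion_eq_zero_of_mem_spectrum [NeZero q] {t : Matrix (Fin 4) (Fin 4) ℂ}
    {B : ZMod q → Matrix (Fin 4) (Fin 4) ℂ} {k e : ℝ} (h : e ∈ spectrum ℝ (blochOperator t B k)) :
    dispersion t B (k, e) = 0 := by
  by_contra hne
  have h1 : IsUnit ((e : ℂ) • (1 : Matrix (ZMod q × Fin 4) (ZMod q × Fin 4) ℂ) -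
      blochMatrix t B k) := (Matrix.isUnit_iff_isUnit_det _).2 (isUnit_iff_ne_zero.2 hne)
  have h2 := h1.map (Matrix.toEuclideanCLM (𝕜 := ℂ) (n := ZMod q × Fin 4))
  rw [map_sub, map_smul, map_one] at h2
  refine h ?_
  change IsUnit (algebraMap ℝ _ e - blochOperator t B k)
  convert h2 using 2
  · rw [Algebra.algebraMap_eq_smul_one, RCLike.real_smul_eq_coe_smul (K := ℂ)]
    rfl
  · rfl

end DiracHarper

/-! ### Spectral forms as functions of the test function and of the operator. -/

namespace SpectralTheory

variable {E : Type*} [NormedAddCommGroup E] [InnerProductSpace ℂ E] [CompleteSpace E]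

theorem spectralForm_add_fun (T : E →L[ℂ] E) {f g : ℝ → ℝ} (hf : Continuous f) (hg : Continuous g)
    (ψ : E) : spectralForm T (fun x => f x + g x) ψ = spectralForm T f ψ + spectralForm T g ψ := by
  have h : functionalCalculus T (fun x => f x + g x) =
      functionalCalculus T f + functionalCalculus T g :=
    cfc_add T f g hf.continuousOn hg.continuousOn
  rw [spectralForm, h, _root_.add_apply, inner_add_right, Complex.add_re]
  rfl

theorem spectralForm_const_mul_fun (T : E →L[ℂ] E) {f : ℝ → ℝ} (hf : Continuous f) (c : ℝ)
    (ψ : E) : spectralForm T (fun x => c * f x) ψ = c * spectralForm T f ψ := by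
  have h : functionalCalculus T (fun x => c * f x) = c • functionalCalculus T f :=
    cfc_smul c f T hf.continuousOn
  rw [spectralForm, h, _root_.smul_apply, RCLike.real_smul_eq_coe_smul (K := ℂ), inner_smul_right]
  simp [spectralForm]

theorem spectralForm_pow {T : E →L[ℂ] E} (hT : IsSelfAdjoint T) (l : ℕ) (ψ : E) :
    spectralForm T (fun x => x ^ l) ψ = (⟪ψ, (T ^ l) ψ⟫_ℂ).re := by
  have h : functionalCalculus T (fun x => x ^ l) = T ^ l := cfc_pow_id (R := ℝ) T l hT
  rw [spectralForm, h]

theorem abs_spectralForm_sub_le (T : E →L[ℂ] E) {f g : ℝ → ℝ} (hf : Continuous f)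
    (hg : Continuous g) {ε : ℝ} (hε : 0 ≤ ε) (h : ∀ x ∈ spectrum ℝ T, |f x - g x| ≤ ε) (ψ : E) :
    |spectralForm T f ψ - spectralForm T g ψ| ≤ ε * ‖ψ‖ ^ 2 := by
  have h1 : functionalCalculus T (fun x => f x - g x) =
      functionalCalculus T f - functionalCalculus T g :=
    cfc_sub f g T hf.continuousOn hg.continuousOn
  have h2 : ‖functionalCalculus T (fun x => f x - g x)‖ ≤ ε := norm_cfc_le hε h
  have h3 : spectralForm T f ψ - spectralForm T g ψ =
      (⟪ψ, functionalCalculus T (fun x => f x - g x) ψ⟫_ℂ).re := by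
    rw [h1, _root_.sub_apply, inner_sub_right, Complex.sub_re, spectralForm, spectralForm]
  rw [h3]
  calc _ ≤ ‖⟪ψ, functionalCalculus T (fun x => f x - g x) ψ⟫_ℂ‖ := Complex.abs_re_le_norm _
    _ ≤ ‖ψ‖ * ‖functionalCalculus T (fun x => f x - g x) ψ‖ := norm_inner_le_norm _ _
    _ ≤ ‖ψ‖ * (ε * ‖ψ‖) := by
      gcongr
      exact ContinuousLinearMap.le_of_opNorm_le _ h2 ψ
    _ = ε * ‖ψ‖ ^ 2 := by ring

theorem spectrum_subset_Icc (T : E →L[ℂ] E) {R : ℝ} (hR : ‖T‖ ≤ R) :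
    spectrum ℝ T ⊆ Set.Icc (-R) R := by
  rcases subsingleton_or_nontrivial E with h | h
  · rw [spectrum.of_subsingleton]; exact Set.empty_subset _
  · intro x hx
    exact abs_le.1 ((spectrum.norm_le_norm_of_mem hx).trans hR)

theorem continuous_spectralForm {X : Type*} [TopologicalSpace X] {A : X → E →L[ℂ] E}
    (hA : Continuous A) (hA' : ∀ x, IsSelfAdjoint (A x)) {f : ℝ → ℝ} (hf : Continuous f) (ψ : E) :
    Continuous fun x => spectralForm (A x) f ψ := by
  have h : Continuous fun x => functionalCalculus (A x) f :=
    hA.cfc_of_mem_nhdsSet f (s := Set.univ) Filter.univ_mem hA' hf.continuousOn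
  unfold spectralForm
  fun_prop

/-- The compact spectrum keeps a positive distance from `K`, so narrow tents vanish on it, and only
values on the spectrum matter. -/
theorem spectralForm_tent_eventually_eq_zero (T : E →L[ℂ] E) {K : Set ℝ} (hK : IsClosed K)
    (hne : K.Nonempty) (h : Disjoint (spectrum ℝ T) K) (ψ : E) :
    ∀ᶠ n in atTop, spectralForm T (tent K n) ψ = 0 := by
  have hc : IsCompact (spectrum ℝ T) := spectrum.isCompact T
  obtain ⟨δ, hδ, hδ'⟩ : ∃ δ > 0, ∀ x ∈ spectrum ℝ T, δ ≤ Metric.infDist x K := by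
    rcases (spectrum ℝ T).eq_empty_or_nonempty with h0 | h0
    · exact ⟨1, one_pos, by simp [h0]⟩
    · obtain ⟨y, hy, hmin⟩ :=
        hc.exists_isMinOn h0 (Metric.continuous_infDist_pt K).continuousOn
      exact ⟨_, (hK.notMem_iff_infDist_pos hne).1 (Set.disjoint_left.1 h hy), hmin⟩
  filter_upwards [eventually_tent_eq_zero hδ] with n hn
  have h1 : functionalCalculus T (tent K n) = functionalCalculus T (fun _ => 0) :=
    cfc_congr fun x hx => hn x (hδ' x hx)
  have h2 : functionalCalculus T (fun _ => 0) = 0 := cfc_const_zero ℝ T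
  rw [spectralForm, h1, h2]
  simp

end SpectralTheory

/-! ### Floquet representation and purely absolutely continuous spectrum. -/

namespace DiracHarper

open SpectralTheory

variable {q : ℕ} {t : Matrix (Fin 4) (Fin 4) ℂ} {B : ZMod q → Matrix (Fin 4) (Fin 4) ℂ}
  {T : Space →L[ℂ] Space}

/-- `T` is the block Jacobi operator with constant hopping `t` and periodic potential `B`. -/
def IsPeriodicJacobi (t : Matrix (Fin 4) (Fin 4) ℂ) (B : ZMod q → Matrix (Fin 4) (Fin 4) ℂ)
    (T : Space →L[ℂ] Space) : Prop :=
  ∀ (ψ : Space) (n : ℤ) (i : Fin 4), T ψ n i = ∑ j, t i j * ψ (n + 1) j +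
    ∑ j, t i j * ψ (n - 1) j + ∑ j, B n i j * ψ n j

/-- The inverse Floquet transform intertwines the Bloch operators with the periodic operator. -/
theorem IsPeriodicJacobi.apply_eq_integral [NeZero q] (hT : IsPeriodicJacobi t B T)
    {c : ℝ → EuclideanSpace ℂ (ZMod q × Fin 4)} (hc : Continuous c) {ψ : Space}
    (hψ : ∀ (m : ℤ) i, ψ m i = ∫ k in (0 : ℝ)..1, phase (m * k) * c k (m, i)) (m : ℤ) (i : Fin 4) :
    T ψ m i = ∫ k in (0 : ℝ)..1, phase (m * k) * blochOperator t B k (c k) (m, i) := by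
  have hph : ∀ a : ℝ, Continuous fun k : ℝ => phase (a * k) := fun a =>
    continuous_phase.comp (continuous_const.mul continuous_id)
  have hcc : ∀ a, Continuous fun k => c k a := fun a =>
    (EuclideanSpace.proj (𝕜 := ℂ) a).continuous.comp hc
  have key : ∀ (M : Matrix (Fin 4) (Fin 4) ℂ) (n : ℤ), ∑ j, M i j * ψ n j =
      ∫ k in (0 : ℝ)..1, ∑ j, M i j * (phase (n * k) * c k (n, j)) := by
    intro M n
    rw [intervalIntegral.integral_finsetSum]
    · exact Finset.sum_congr rfl fun j _ => by rw [intervalIntegral.integral_const_mul, hψ]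
    · exact fun j _ =>
        (continuous_const.mul ((hph n).mul (hcc (n, j)))).intervalIntegrable _ _
  have hint : ∀ (M : Matrix (Fin 4) (Fin 4) ℂ) (n : ℤ), IntervalIntegrable
      (fun k => ∑ j, M i j * (phase (n * k) * c k (n, j))) volume 0 1 := fun M n =>
    (continuous_finsetSum _ fun j _ =>
      continuous_const.mul ((hph n).mul (hcc (n, j)))).intervalIntegrable _ _
  rw [hT, key, key, key, ← intervalIntegral.integral_add (hint _ _) (hint _ _),
    ← intervalIntegral.integral_add ((hint _ _).add (hint _ _)) (hint _ _)]
  refine intervalIntegral.integral_congr fun k _ => ?_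
  have e1 : phase ((m + 1) * k) = phase (m * k) * phase k := by
    rw [← phase_add]; ring_nf
  have e2 : phase ((m - 1) * k) = phase (m * k) * phase (-k) := by
    rw [← phase_add]; ring_nf
  simp only [blochOperator_apply, Int.cast_add, Int.cast_sub, Int.cast_one, e1, e2, mul_add,
    Finset.mul_sum]
  congr 1
  · congr 1 <;> exact Finset.sum_congr rfl fun j _ => by ring
  · exact Finset.sum_congr rfl fun j _ => by ring

/-- The unit vectors of the Bloch fibre. -/
abbrev cellVec (r : ZMod q) (j : Fin 4) : EuclideanSpace ℂ (ZMod q × Fin 4) :=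
  EuclideanSpace.single (r, j) 1

/-- With `k` over a full unit interval, not `[0, 1/q]`, orthogonality of phases alone selects `m =
n`; the residue condition is then automatic. -/
theorem basisVec_apply_eq_integral (n : ℤ) (j : Fin 4) (m : ℤ) (i : Fin 4) :
    basisVec n j m i = ∫ k in (0 : ℝ)..1,
      phase (m * k) * (phase (-n * k) • cellVec (n : ZMod q) j) (m, i) := by
  have h : ∀ k : ℝ, phase (m * k) * (phase (-n * k) • cellVec (n : ZMod q) j) (m, i) =
      phase ((m - n : ℤ) * k) * if ((m : ZMod q), i) = ((n : ZMod q), j) then 1 else 0 := fun k => by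
    have : phase ((m - n : ℤ) * k) = phase (m * k) * phase (-n * k) := by
      rw [← phase_add]; push_cast; ring_nf
    rw [this, PiLp.smul_apply, PiLp.single_apply, smul_eq_mul, mul_assoc]
  simp_rw [h]
  rw [intervalIntegral.integral_mul_const, integral_phase_intCast_mul, basisVec]
  by_cases hmn : m = n
  · subst hmn
    simp [PiLp.single_apply]
  · rw [lp.single_apply_ne _ _ _ hmn, if_neg (sub_ne_zero.2 hmn)]
    simp

theorem IsPeriodicJacobi.pow_basisVec_apply [NeZero q] (hT : IsPeriodicJacobi t B T) (n : ℤ) (j : Fin 4)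
    (l : ℕ) (m : ℤ) (i : Fin 4) :
    (T ^ l) (basisVec n j) m i = ∫ k in (0 : ℝ)..1, phase (m * k) *
      ((blochOperator t B k ^ l) (phase (-n * k) • cellVec (n : ZMod q) j)) (m, i) := by
  induction l generalizing m i with
  | zero => exact basisVec_apply_eq_integral n j m i
  | succ l ih =>
    have hc : Continuous fun k => (blochOperator t B k ^ l)
        (phase (-n * k) • cellVec (n : ZMod q) j) := by
      have h1 := (continuous_blochOperator t B).pow l
      have h2 : Continuous fun k : ℝ => phase (-n * k) :=
        continuous_phase.comp (continuous_const.mul continuous_id)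
      exact h1.clm_apply (h2.smul continuous_const)
    simp only [pow_succ']
    exact hT.apply_eq_integral hc ih m i

theorem inner_basisVec (n : ℤ) (j : Fin 4) (χ : Space) : ⟪basisVec n j, χ⟫_ℂ = χ n j := by
  rw [basisVec, lp.inner_single_left, EuclideanSpace.inner_single_left]
  simp

theorem norm_basisVec (n : ℤ) (j : Fin 4) : ‖basisVec n j‖ = 1 := by
  rw [basisVec, lp.norm_single (by norm_num), PiLp.norm_single, norm_one]

theorem IsPeriodicJacobi.spectralForm_pow [NeZero q] (hT : IsPeriodicJacobi t B T) (hsa : IsSelfAdjoint T)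
    (ht : t.IsHermitian) (hB : ∀ r, (B r).IsHermitian) (n : ℤ) (j : Fin 4) (l : ℕ) :
    spectralForm T (fun x => x ^ l) (basisVec n j) =
      ∫ k in (0 : ℝ)..1, spectralForm (blochOperator t B k) (fun x => x ^ l)
        (cellVec (n : ZMod q) j) := by
  have h1 : ⟪basisVec n j, (T ^ l) (basisVec n j)⟫_ℂ = ∫ k in (0 : ℝ)..1,
      ⟪cellVec (n : ZMod q) j, (blochOperator t B k ^ l) (cellVec (n : ZMod q) j)⟫_ℂ := by
    rw [inner_basisVec, hT.pow_basisVec_apply]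
    refine intervalIntegral.integral_congr fun k _ => ?_
    -- The phases cancel, so the integrand depends on `n` only through its residue mod `q`.
    have : phase (n * k) * phase (-n * k) = 1 := by
      rw [← phase_add]; simp [phase_zero]
    simp only [map_smul, PiLp.smul_apply, smul_eq_mul, ← mul_assoc, this, one_mul,
      EuclideanSpace.inner_single_left, map_one]
  have h2 : Continuous fun k =>
      ⟪cellVec (n : ZMod q) j, (blochOperator t B k ^ l) (cellVec (n : ZMod q) j)⟫_ℂ := by
    exact continuous_const.inner
      (((continuous_blochOperator t B).pow l).clm_apply continuous_const)
  rw [SpectralTheory.spectralForm_pow hsa, h1]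
  have h3 := Complex.reCLM.intervalIntegral_comp_comm
    (h2.intervalIntegrable (μ := volume) 0 1)
  rw [Complex.reCLM_apply] at h3
  rw [← h3]
  refine intervalIntegral.integral_congr fun k _ => ?_
  exact (SpectralTheory.spectralForm_pow (isSelfAdjoint_blochOperator ht hB k) l _).symm

theorem IsPeriodicJacobi.spectralForm_polynomial [NeZero q] (hT : IsPeriodicJacobi t B T)
    (hsa : IsSelfAdjoint T) (ht : t.IsHermitian) (hB : ∀ r, (B r).IsHermitian) (n : ℤ) (j : Fin 4)
    (p : Polynomial ℝ) :
    spectralForm T (fun x => p.eval x) (basisVec n j) =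
      ∫ k in (0 : ℝ)..1, spectralForm (blochOperator t B k) (fun x => p.eval x)
        (cellVec (n : ZMod q) j) := by
  induction p using Polynomial.induction_on' with
  | add p r hp hr =>
    have hc : ∀ p : Polynomial ℝ, IntervalIntegrable (fun k =>
        spectralForm (blochOperator t B k) (fun x => p.eval x) (cellVec (n : ZMod q) j))
        volume 0 1 := fun p => (continuous_spectralForm (continuous_blochOperator t B)
          (isSelfAdjoint_blochOperator ht hB) p.continuous _).intervalIntegrable _ _
    simp only [Polynomial.eval_add]
    rw [spectralForm_add_fun T p.continuous r.continuous, hp, hr,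
      ← intervalIntegral.integral_add (hc p) (hc r)]
    exact intervalIntegral.integral_congr fun k _ =>
      (spectralForm_add_fun _ p.continuous r.continuous _).symm
  | monomial l a =>
    simp only [Polynomial.eval_monomial]
    rw [spectralForm_const_mul_fun T (continuous_pow l), hT.spectralForm_pow hsa ht hB,
      ← intervalIntegral.integral_const_mul]
    exact intervalIntegral.integral_congr fun k _ =>
      (spectralForm_const_mul_fun _ (continuous_pow l) _ _).symm

/-- Floquet representation of the diagonal entries of `f(T)`. -/
theorem IsPeriodicJacobi.spectralForm_basisVec [NeZero q] (hT : IsPeriodicJacobi t B T)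
    (hsa : IsSelfAdjoint T) (ht : t.IsHermitian) (hB : ∀ r, (B r).IsHermitian) (n : ℤ) (j : Fin 4)
    {f : ℝ → ℝ} (hf : Continuous f) :
    spectralForm T f (basisVec n j) =
      ∫ k in (0 : ℝ)..1, spectralForm (blochOperator t B k) f (cellVec (n : ZMod q) j) := by
  obtain ⟨C, hC⟩ := (isCompact_Icc (a := (0 : ℝ)) (b := 1)).exists_bound_of_continuousOn
    (continuous_blochOperator t B).continuousOn
  -- `[-R, R]` contains the spectra of `T` and of all Bloch operators with `k ∈ [0,1]`, so one
  -- polynomial serves both sides, at a cost of `ε / 2` each.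
  set R := max ‖T‖ C
  refine eq_of_forall_dist_le fun ε hε => ?_
  obtain ⟨p, hp⟩ := exists_polynomial_near_of_continuousOn (-R) R f hf.continuousOn (ε / 2)
    (half_pos hε)
  have hp' : ∀ x ∈ Set.Icc (-R) R, |f x - p.eval x| ≤ ε / 2 := fun x hx => by
    rw [abs_sub_comm]; exact (hp x hx).le
  have h1 := abs_spectralForm_sub_le T hf p.continuous (half_pos hε).le
    (fun x hx => hp' x (spectrum_subset_Icc T (le_max_left _ _) hx)) (basisVec n j)
  have hc : ∀ g : ℝ → ℝ, Continuous g → IntervalIntegrable (fun k =>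
      spectralForm (blochOperator t B k) g (cellVec (n : ZMod q) j)) volume 0 1 := fun g hg =>
    (continuous_spectralForm (continuous_blochOperator t B) (isSelfAdjoint_blochOperator ht hB)
      hg _).intervalIntegrable _ _
  have h2 : ‖∫ k in (0 : ℝ)..1, (spectralForm (blochOperator t B k) f (cellVec (n : ZMod q) j) -
      spectralForm (blochOperator t B k) (fun x => p.eval x) (cellVec (n : ZMod q) j))‖ ≤
      (ε / 2) * |1 - 0| := by
    refine intervalIntegral.norm_integral_le_of_norm_le_const fun k hk => ?_
    rw [Set.uIoc_of_le zero_le_one] at hk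
    have := abs_spectralForm_sub_le (blochOperator t B k) hf p.continuous (half_pos hε).le
      (fun x hx => hp' x (spectrum_subset_Icc _
        ((hC k (Set.Ioc_subset_Icc_self hk)).trans (le_max_right _ _)) hx))
      (cellVec (n : ZMod q) j)
    simpa using this
  rw [intervalIntegral.integral_sub (hc f hf) (hc _ p.continuous),
    ← hT.spectralForm_polynomial hsa ht hB, Real.norm_eq_abs] at h2
  rw [norm_basisVec] at h1
  rw [Real.dist_eq]
  have := abs_sub_le (spectralForm T f (basisVec n j))
    (spectralForm T (fun x => p.eval x) (basisVec n j))
    (∫ k in (0 : ℝ)..1, spectralForm (blochOperator t B k) f (cellVec (n : ZMod q) j))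
  rw [abs_sub_comm] at h2
  norm_num at h1 h2
  linarith

theorem IsPeriodicJacobi.spectralMeasure_basisVec_congr [NeZero q] (hT : IsPeriodicJacobi t B T)
    (hsa : IsSelfAdjoint T) (ht : t.IsHermitian) (hB : ∀ r, (B r).IsHermitian) {m n : ℤ}
    (h : (m : ZMod q) = n) (j : Fin 4) :
    spectralMeasure T (basisVec m j) = spectralMeasure T (basisVec n j) :=
  spectralMeasure_congr T fun f hf => by
    rw [hT.spectralForm_basisVec hsa ht hB m j hf, hT.spectralForm_basisVec hsa ht hB n j hf, h]

/-- For almost every `k` the Bloch spectrum misses the null set `K`, so the integrand is eventually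
`0`; it is dominated by `1`. -/
theorem IsPeriodicJacobi.tendsto_spectralForm_tent [NeZero q] (hT : IsPeriodicJacobi t B T)
    (hsa : IsSelfAdjoint T) (ht : t.IsHermitian) (hu : IsUnit t) (hB : ∀ r, (B r).IsHermitian)
    {K : Set ℝ} (hK : IsCompact K) (hne : K.Nonempty) (hK0 : volume K = 0) (n : ℤ) (j : Fin 4) :
    Tendsto (fun l => spectralForm T (tent K l) (basisVec n j)) atTop (𝓝 0) := by
  simp_rw [hT.spectralForm_basisVec hsa ht hB n j (continuous_tent K _)]
  suffices h : Tendsto (fun l => ∫ k in (0 : ℝ)..1, spectralForm (blochOperator t B k) (tent K l)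
      (cellVec (n : ZMod q) j)) atTop (𝓝 (∫ _ in (0 : ℝ)..1, (0 : ℝ))) by
    simpa using h
  refine intervalIntegral.tendsto_integral_filter_of_dominated_convergence (fun _ => 1)
    (Eventually.of_forall fun l => (continuous_spectralForm (continuous_blochOperator t B)
      (isSelfAdjoint_blochOperator ht hB) (continuous_tent K l) _).aestronglyMeasurable)
    (Eventually.of_forall fun l => Eventually.of_forall fun k _ => ?_)
    (intervalIntegrable_const (μ := volume)) ?_
  · rw [Real.norm_of_nonneg (spectralForm_nonneg _ (tent_nonneg K l) _)]
    simpa using spectralForm_le (blochOperator t B k) (abs_tent_le_one K l)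
      (cellVec (n : ZMod q) j)
  · have hnull := measure_eq_zero_iff_ae_notMem.1 (volume_exists_dispersion_eq_zero hu B hK0)
    filter_upwards [hnull] with k hk _
    refine tendsto_const_nhds.congr' ?_
    have hd : Disjoint (spectrum ℝ (blochOperator t B k)) K :=
      Set.disjoint_left.2 fun e he heK => hk ⟨e, heK, dispersion_eq_zero_of_mem_spectrum he⟩
    filter_upwards [spectralForm_tent_eventually_eq_zero _ hK.isClosed hne hd
      (cellVec (n : ZMod q) j)] with l hl
    exact hl.symm

theorem eq_top_of_basisVec_mem {S : Submodule ℂ Space} (hS : IsClosed (S : Set Space))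
    (h : ∀ n j, basisVec n j ∈ S) : S = ⊤ := by
  refine Submodule.eq_top_iff'.2 fun ψ => ?_
  have hs : ∀ (n : ℤ) (v : Fibre), lp.single 2 n v ∈ S := by
    intro n v
    have : lp.single 2 n v = ∑ j, v j • basisVec n j := by
      have hv : v = ∑ j, v j • EuclideanSpace.single j (1 : ℂ) := by
        ext i
        simp [Pi.single_apply]
      conv_lhs => rw [hv]
      rw [← lp.lsingle_apply (𝕜 := ℂ), map_sum]
      exact Finset.sum_congr rfl fun j _ => lp.single_smul _ _ _ _
    rw [this]
    exact S.sum_mem fun j _ => S.smul_mem _ (h n j)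
  exact hS.mem_of_tendsto (lp.hasSum_single (by norm_num) ψ)
    (Eventually.of_forall fun s => S.sum_mem fun n _ => hs n _)

/-- For each compact null `K`, the vectors with vanishing tent limit form a closed subspace
containing every basis vector. -/
theorem IsPeriodicJacobi.hasPurelyACSpectrum [NeZero q] (hT : IsPeriodicJacobi t B T)
    (hsa : IsSelfAdjoint T) (ht : t.IsHermitian) (hu : IsUnit t) (hB : ∀ r, (B r).IsHermitian) :
    HasPurelyACSpectrum T := by
  refine ⟨hsa, fun ψ => spectralMeasure_absolutelyContinuous T ψ fun K hK hne hK0 => ?_⟩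
  have := eq_top_of_basisVec_mem
    (isClosed_vanishingSubspace T (tent K) (tent_nonneg K) (tent_le_one K))
    fun n j => hT.tendsto_spectralForm_tent hsa ht hu hB hK hne hK0 n j
  exact Submodule.eq_top_iff'.1 this ψ

end DiracHarper

/-! ### Averages of periodic sequences and continuity of distribution functions. -/

theorem abs_card_filter_intCast_eq_sub_le (q : ℕ) [NeZero q] (r : ZMod q) (N : ℕ) :
    |(((Finset.Icc (-(N : ℤ)) N).filter fun n : ℤ => (n : ZMod q) = r).card : ℝ) -
      (2 * N + 1) / q| ≤ 1 := by
  have hq : (0 : ℤ) < q := by exact_mod_cast NeZero.pos q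
  have hset : (Finset.Icc (-(N : ℤ)) N).filter (fun n : ℤ => (n : ZMod q) = r) =
      (Finset.Ioc (-(N : ℤ) - 1) N).filter (fun n => n ≡ (r.val : ℤ) [ZMOD q]) := by
    ext n
    have h : (n : ZMod q) = r ↔ n ≡ (r.val : ℤ) [ZMOD q] := by
      rw [← ZMod.intCast_eq_intCast_iff]; simp
    simp only [Finset.mem_filter, Finset.mem_Icc, Finset.mem_Ioc, h]
    constructor <;> rintro ⟨h1, h2⟩ <;> exact ⟨⟨by omega, by omega⟩, h2⟩
  -- The count is a difference of two floors, each within `1` of its argument on the same side, so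
  -- the total error is at most `1`.
  have hcard := Int.Ioc_filter_modEq_card (-(N : ℤ) - 1) N hq (r.val : ℤ)
  rw [← hset] at hcard
  set c := ((Finset.Icc (-(N : ℤ)) N).filter fun n : ℤ => (n : ZMod q) = r).card
  set x : ℚ := ((N : ℤ) - (r.val : ℤ)) / ((q : ℤ) : ℚ)
  set y : ℚ := ((-(N : ℤ) - 1 : ℤ) - (r.val : ℤ)) / ((q : ℤ) : ℚ) with hy
  have hxy : x - y = (2 * N + 1) / q := by
    simp only [x, y]; push_cast; ring
  have hpos : (0 : ℚ) ≤ (2 * N + 1) / q := by positivity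
  have h1 : (⌊x⌋ : ℚ) ≤ x := Int.floor_le x
  have h2 : x < ⌊x⌋ + 1 := Int.lt_floor_add_one x
  have h3 : (⌊y⌋ : ℚ) ≤ y := Int.floor_le y
  have h4 : y < ⌊y⌋ + 1 := Int.lt_floor_add_one y
  have hc : (c : ℚ) = max ((⌊x⌋ : ℚ) - ⌊y⌋) 0 := by exact_mod_cast hcard
  have key : |(c : ℚ) - (2 * N + 1) / q| ≤ 1 := by
    rw [← hxy] at hpos ⊢
    rw [hc, abs_le]
    rcases max_cases ((⌊x⌋ : ℚ) - ⌊y⌋) 0 with h | h <;> constructor <;> linarith [h.1, h.2]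
  have key' := (Rat.cast_le (K := ℝ)).2 key
  push_cast at key'
  exact key'

/-- The averages of a periodic sequence over `{-N, …, N}` converge to its mean over a period. -/
theorem tendsto_average_periodic (q : ℕ) [NeZero q] (a : ZMod q → ℝ) :
    Tendsto (fun N : ℕ => (∑ n ∈ Finset.Icc (-(N : ℤ)) N, a n) / (2 * (N : ℝ) + 1)) atTop
      (𝓝 ((q : ℝ)⁻¹ * ∑ r, a r)) := by
  have hsum : ∀ N : ℕ, (∑ n ∈ Finset.Icc (-(N : ℤ)) N, a n) / (2 * (N : ℝ) + 1) =
      ∑ r, (((Finset.Icc (-(N : ℤ)) N).filter fun n : ℤ => (n : ZMod q) = r).card : ℝ) /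
        (2 * N + 1) * a r := by
    intro N
    rw [← Finset.sum_fiberwise _ (fun n : ℤ => (n : ZMod q)), Finset.sum_div]
    refine Finset.sum_congr rfl fun r _ => ?_
    rw [Finset.sum_congr rfl fun n hn => by rw [(Finset.mem_filter.1 hn).2], Finset.sum_const,
      nsmul_eq_mul]
    ring
  simp_rw [hsum, Finset.mul_sum]
  refine tendsto_finsetSum _ fun r _ => Tendsto.mul_const _ ?_
  have hlim : Tendsto (fun N : ℕ => 1 / (2 * (N : ℝ) + 1)) atTop (𝓝 0) := by
    refine tendsto_const_nhds.div_atTop (tendsto_atTop_add_const_right _ _ ?_)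
    exact tendsto_natCast_atTop_atTop.const_mul_atTop two_pos
  rw [tendsto_iff_dist_tendsto_zero]
  refine squeeze_zero (fun _ => dist_nonneg) (fun N => ?_) hlim
  have hN : (0 : ℝ) < 2 * N + 1 := by positivity
  have h := abs_card_filter_intCast_eq_sub_le q r N
  rw [Real.dist_eq]
  set c : ℝ := (((Finset.Icc (-(N : ℤ)) N).filter fun n : ℤ => (n : ZMod q) = r).card : ℝ)
  have : c / (2 * N + 1) - (q : ℝ)⁻¹ = (c - (2 * N + 1) / q) / (2 * N + 1) := by
    field_simp
  rw [this, abs_div, abs_of_pos hN]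
  gcongr

theorem continuous_measureReal_Iic (ν : Measure ℝ) [IsFiniteMeasure ν] (h : ν ≪ volume) :
    Continuous fun E : ℝ => ν.real (Set.Iic E) := by
  -- Without atoms, the primitive of the constant `1` against `ν` is continuous.
  have : NullSingletonClass ν := ⟨fun x => h Real.volume_singleton⟩
  have h1 : ∀ E : ℝ, ν.real (Set.Iic E) = (∫ _ in (0 : ℝ)..E, (1 : ℝ) ∂ν) + ν.real (Set.Iic 0) := by
    intro E
    rw [← intervalIntegral.integral_Iic_sub_Iic (integrable_const _).integrableOn
      (integrable_const _).integrableOn]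
    simp only [setIntegral_const, smul_eq_mul, mul_one, sub_add_cancel]
  rw [funext h1]
  exact (intervalIntegral.continuous_primitive
    (fun a b => intervalIntegrable_const) 0).add continuous_const

/-! ### The density of states of a periodic operator. -/

namespace DiracHarper

open SpectralTheory

/-- The density of states of a `q`-periodic operator: the mean over one period of the spectral
measures of the basis vectors. -/
def periodicDensityOfStates (q : ℕ) [NeZero q] (T : Space →L[ℂ] Space) : Measure ℝ :=
  (q : ℝ≥0)⁻¹ • ∑ r : ZMod q, ∑ j : Fin 4, spectralMeasure T (basisVec (r.val : ℤ) j)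

instance isFiniteMeasure_periodicDensityOfStates (q : ℕ) [NeZero q] (T : Space →L[ℂ] Space) :
    IsFiniteMeasure (periodicDensityOfStates q T) := by
  unfold periodicDensityOfStates
  infer_instance

theorem periodicDensityOfStates_absolutelyContinuous (q : ℕ) [NeZero q] {T : Space →L[ℂ] Space}
    (h : HasPurelyACSpectrum T) : periodicDensityOfStates q T ≪ volume := by
  intro s hs
  have : ∀ ψ, spectralMeasure T ψ s = 0 := fun ψ => h.2 ψ hs
  simp [periodicDensityOfStates, Measure.finsetSum_apply, this]

theorem periodicDensityOfStates_real (q : ℕ) [NeZero q] (T : Space →L[ℂ] Space) (s : Set ℝ) :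
    (periodicDensityOfStates q T).real s =
      (q : ℝ)⁻¹ * ∑ r : ZMod q, ∑ j : Fin 4,
        (spectralMeasure T (basisVec (r.val : ℤ) j)).real s := by
  rw [periodicDensityOfStates, measureReal_nnreal_smul_apply]
  simp [measureReal_def, Measure.finsetSum_apply, ENNReal.toReal_sum]

theorem integral_periodicDensityOfStates (q : ℕ) [NeZero q] (T : Space →L[ℂ] Space) {f : ℝ → ℝ}
    (hf : Continuous f) (hf' : HasCompactSupport f) :
    ∫ x, f x ∂(periodicDensityOfStates q T) =
      (q : ℝ)⁻¹ * ∑ r : ZMod q, ∑ j : Fin 4, spectralForm T f (basisVec (r.val : ℤ) j) := by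
  have hint : ∀ ψ, Integrable f (spectralMeasure T ψ) := fun ψ =>
    hf.integrable_of_hasCompactSupport hf'
  rw [periodicDensityOfStates, integral_smul_nnreal_measure, integral_finsetSum_measure
    fun r _ => integrable_finsetSum_measure.2 fun j _ => hint _]
  simp only [integral_finsetSum_measure fun j _ => hint _,
    integral_spectralMeasure_eq_spectralForm T _ hf hf']
  simp [NNReal.smul_def]

variable {q : ℕ} [NeZero q] {t : Matrix (Fin 4) (Fin 4) ℂ} {B : ZMod q → Matrix (Fin 4) (Fin 4) ℂ}
  {T : Space →L[ℂ] Space}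

theorem intCast_val_intCast (n : ℤ) : ((((n : ZMod q).val : ℕ) : ℤ) : ZMod q) = (n : ZMod q) := by
  simp

theorem IsPeriodicJacobi.isDensityOfStates (hT : IsPeriodicJacobi t B T)
    (hsa : IsSelfAdjoint T) (ht : t.IsHermitian) (hB : ∀ r, (B r).IsHermitian) :
    IsDensityOfStates T (periodicDensityOfStates q T) := by
  refine ⟨inferInstance, fun f hf hf' => ?_⟩
  have hc := hf.continuous
  rw [integral_periodicDensityOfStates q T hc hf']
  have h := tendsto_average_periodic q fun r =>
    ∑ j : Fin 4, spectralForm T f (basisVec (r.val : ℤ) j)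
  refine ((Complex.continuous_ofReal.tendsto _).comp h).congr fun N => ?_
  have hp : ∀ (n : ℤ) j, spectralForm T f (basisVec ((n : ZMod q).val : ℤ) j) =
      spectralForm T f (basisVec n j) := fun n j => by
    rw [hT.spectralForm_basisVec hsa ht hB _ j hc, hT.spectralForm_basisVec hsa ht hB n j hc,
      intCast_val_intCast]
  simp only [Function.comp_apply, localTrace, inner_functionalCalculus_self, hp]
  push_cast
  rfl

/-- The spectral measures themselves are periodic in the site, so the averages converge at every `E`
without any weak-convergence argument. -/
theorem IsPeriodicJacobi.tendsto_localIDS (hT : IsPeriodicJacobi t B T)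
    (hsa : IsSelfAdjoint T) (ht : t.IsHermitian) (hB : ∀ r, (B r).IsHermitian) (E : ℝ) :
    Tendsto (fun N : ℕ => localIDS T N E) atTop
      (𝓝 ((periodicDensityOfStates q T).real (Set.Iic E))) := by
  rw [periodicDensityOfStates_real]
  refine (tendsto_average_periodic q fun r => ∑ j : Fin 4,
    (spectralMeasure T (basisVec (r.val : ℤ) j)).real (Set.Iic E)).congr fun N => ?_
  have hp : ∀ (n : ℤ) j, spectralMeasure T (basisVec ((n : ZMod q).val : ℤ) j) =
      spectralMeasure T (basisVec n j) := fun n j =>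
    hT.spectralMeasure_basisVec_congr hsa ht hB (intCast_val_intCast n) j
  simp only [localIDS, hp]

/-! ### Self-adjointness, invertible hopping and periodicity of the Dirac–Harper Hamiltonian. -/

theorem inner_shift (k : ℤ) (ψ χ : Space) : ⟪shift k ψ, χ⟫_ℂ = ⟪ψ, shift (-k) χ⟫_ℂ := by
  rw [lp.inner_eq_tsum, lp.inner_eq_tsum,
    ← (Equiv.addRight k).tsum_eq fun n => ⟪ψ n, shift (-k) χ n⟫_ℂ]
  refine tsum_congr fun n => ?_
  simp

theorem inner_act {A : Matrix (Fin 4) (Fin 4) ℂ} (hA : A.IsHermitian) (v w : Fibre) :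
    ⟪act A v, w⟫_ℂ = ⟪v, act A w⟫_ℂ := by
  have h : IsSelfAdjoint (act A) :=
    IsSelfAdjoint.map hA.isSelfAdjoint (Matrix.toEuclideanCLM (𝕜 := ℂ) (n := Fin 4))
  exact (ContinuousLinearMap.isSelfAdjoint_iff_isSymmetric.1 h) v w

theorem inner_block {A : ℤ → Matrix (Fin 4) (Fin 4) ℂ} (hA : ∀ n, (A n).IsHermitian) {C : ℝ}
    (hC : ∀ n, ‖act (A n)‖ ≤ C) (ψ χ : Space) :
    ⟪block (fun n => act (A n)) hC ψ, χ⟫_ℂ = ⟪ψ, block (fun n => act (A n)) hC χ⟫_ℂ := by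
  rw [lp.inner_eq_tsum, lp.inner_eq_tsum]
  exact tsum_congr fun n => inner_act (hA n) _ _

theorem act_apply (A : Matrix (Fin 4) (Fin 4) ℂ) (v : Fibre) (i : Fin 4) :
    act A v i = ∑ j, A i j * v j := rfl

theorem isHermitian_gamma15 : gamma15.IsHermitian := by
  refine Matrix.IsHermitian.ext fun i j => ?_
  fin_cases i <;> fin_cases j <;> simp [gamma15]

theorem isHermitian_gamma25 : gamma25.IsHermitian := by
  refine Matrix.IsHermitian.ext fun i j => ?_
  fin_cases i <;> fin_cases j <;> simp [gamma25]

theorem isHermitian_hopping (θ : ℝ) : (hopping θ).IsHermitian := by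
  unfold hopping
  refine (isHermitian_gamma15.smul ?_).add (isHermitian_gamma25.smul ?_) <;>
    exact Complex.conj_ofReal _

theorem isHermitian_potential (L w₀ w₁ φ ϑ : ℝ) (n : ℤ) :
    (potential L w₀ w₁ φ ϑ n).IsHermitian := by
  refine Matrix.IsHermitian.ext fun i j => ?_
  unfold potential
  generalize w₀ * profileU (ϑ + (n - φ) / L) = a
  generalize w₀ * profileU (ϑ + (n + φ) / L) = b
  generalize w₁ * profilePlus (ϑ + n / L) = c
  generalize w₁ * profileMinus (ϑ + n / L) = d
  fin_cases i <;> fin_cases j <;> simp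

/-- `γ₁₅` and `γ₂₅` anticommute and square to `1`, leaving `cos² + sin²`. This supplies the
invertible hopping behind the absence of flat bands. -/
theorem hopping_mul_self (θ : ℝ) : hopping θ * hopping θ = 1 := by
  have h : (Real.cos (2 * Real.pi * θ) : ℂ) * Real.cos (2 * Real.pi * θ) +
      Real.sin (2 * Real.pi * θ) * Real.sin (2 * Real.pi * θ) = 1 := by
    have := Real.cos_sq_add_sin_sq (2 * Real.pi * θ)
    exact_mod_cast (by linarith [this] : Real.cos (2 * Real.pi * θ) * Real.cos (2 * Real.pi * θ) +
      Real.sin (2 * Real.pi * θ) * Real.sin (2 * Real.pi * θ) = 1)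
  unfold hopping
  generalize (Real.cos (2 * Real.pi * θ) : ℂ) = c at h ⊢
  generalize (Real.sin (2 * Real.pi * θ) : ℂ) = s at h ⊢
  ext i j
  fin_cases i <;> fin_cases j <;>
    simp [gamma15, gamma25, Matrix.mul_apply, Fin.sum_univ_four] <;>
    linear_combination h - s ^ 2 * Complex.I_sq

theorem isUnit_hopping (θ : ℝ) : IsUnit (hopping θ) :=
  IsUnit.of_mul_eq_one _ (hopping_mul_self θ)

theorem cos_two_pi_add_intCast (x : ℝ) (m : ℤ) :
    Real.cos (2 * Real.pi * (x + m)) = Real.cos (2 * Real.pi * x) := by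
  rw [← Real.cos_add_int_mul_two_pi (2 * Real.pi * x) m]; ring_nf

theorem sin_two_pi_add_intCast (x : ℝ) (m : ℤ) :
    Real.sin (2 * Real.pi * (x + m)) = Real.sin (2 * Real.pi * x) := by
  rw [← Real.sin_add_int_mul_two_pi (2 * Real.pi * x) m]; ring_nf

/-- Moving by `r.den` sites shifts each profile argument by the integer `r.num`, whatever `φ` and
`ϑ` are, and the profiles have period `1`. -/
theorem potential_congr {L : ℝ} {r : ℚ} (hr : 1 / L = (r : ℝ)) (w₀ w₁ φ ϑ : ℝ) {m n : ℤ}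
    (h : (m : ZMod r.den) = n) : potential L w₀ w₁ φ ϑ m = potential L w₀ w₁ φ ϑ n := by
  obtain ⟨l, hl⟩ := (ZMod.intCast_eq_intCast_iff_dvd_sub n m r.den).1 h.symm
  have hden : (r.den : ℝ) * (1 / L) = r.num := by
    rw [hr]; exact_mod_cast Rat.den_mul_eq_num r
  have hm : (m : ℝ) / L = n / L + ((l * r.num : ℤ) : ℝ) := by
    have : (m : ℝ) = n + r.den * l := by
      have : m = n + r.den * l := by linarith
      exact_mod_cast this
    rw [this]; push_cast; rw [← hden]; ring
  have e1 : ϑ + ((m : ℝ) - φ) / L = ϑ + (n - φ) / L + ((l * r.num : ℤ) : ℝ) := by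
    rw [sub_div, hm]; ring
  have e2 : ϑ + ((m : ℝ) + φ) / L = ϑ + (n + φ) / L + ((l * r.num : ℤ) : ℝ) := by
    rw [add_div, hm]; ring
  have e3 : ϑ + (m : ℝ) / L = ϑ + n / L + ((l * r.num : ℤ) : ℝ) := by
    rw [hm]; ring
  simp only [potential, profileU, profilePlus, profileMinus, e1, e2, e3, cos_two_pi_add_intCast,
    sin_two_pi_add_intCast]

theorem isSelfAdjoint_hamiltonian (L w₀ w₁ θ φ ϑ : ℝ) :
    IsSelfAdjoint (hamiltonian L w₀ w₁ θ φ ϑ) := by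
  refine ContinuousLinearMap.isSelfAdjoint_iff_isSymmetric.2 fun ψ χ => ?_
  -- The hopping matrix is the same at every site, so it commutes with shifts; the adjoint only
  -- swaps `shift 1` and `shift (-1)`.
  have hcomm : ∀ k, shift k (block (fun _ => act (hopping θ)) (fun _ => le_rfl) χ) =
      block (fun _ => act (hopping θ)) (fun _ => le_rfl) (shift k χ) := fun k => rfl
  change ⟪block (fun _ => act (hopping θ)) (fun _ => le_rfl) (shift 1 ψ + shift (-1) ψ) +
      block (fun _ => act gamma15) (fun _ => le_rfl) ψ +
      block (fun n => act (potential L w₀ w₁ φ ϑ n))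
        (exists_bound_potential L w₀ w₁ φ ϑ).choose_spec ψ, χ⟫_ℂ =
    ⟪ψ, block (fun _ => act (hopping θ)) (fun _ => le_rfl) (shift 1 χ + shift (-1) χ) +
      block (fun _ => act gamma15) (fun _ => le_rfl) χ +
      block (fun n => act (potential L w₀ w₁ φ ϑ n))
        (exists_bound_potential L w₀ w₁ φ ϑ).choose_spec χ⟫_ℂ
  rw [inner_add_left, inner_add_left, inner_add_right, inner_add_right,
    inner_block (fun _ => isHermitian_hopping θ), inner_block (fun _ => isHermitian_gamma15),
    inner_block (isHermitian_potential L w₀ w₁ φ ϑ), inner_add_left, inner_shift, inner_shift,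
    hcomm, hcomm, neg_neg, map_add, inner_add_right, add_comm ⟪ψ, block _ _ (shift (-1) χ)⟫_ℂ]

/-- The onsite term of the Hamiltonian over one period. -/
def cellPotential (q : ℕ) (L w₀ w₁ φ ϑ : ℝ) (r : ZMod q) : Matrix (Fin 4) (Fin 4) ℂ :=
  gamma15 + potential L w₀ w₁ φ ϑ (r.val : ℤ)

theorem isHermitian_cellPotential (q : ℕ) (L w₀ w₁ φ ϑ : ℝ) (r : ZMod q) :
    (cellPotential q L w₀ w₁ φ ϑ r).IsHermitian :=
  isHermitian_gamma15.add (isHermitian_potential _ _ _ _ _ _)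

theorem isPeriodicJacobi_hamiltonian {L : ℝ} {r : ℚ} (hr : 1 / L = (r : ℝ)) (w₀ w₁ θ φ ϑ : ℝ) :
    IsPeriodicJacobi (hopping θ) (cellPotential r.den L w₀ w₁ φ ϑ)
      (hamiltonian L w₀ w₁ θ φ ϑ) := by
  intro ψ n i
  have : NeZero r.den := ⟨r.den_nz⟩
  have h : potential L w₀ w₁ φ ϑ ((n : ZMod r.den).val : ℤ) = potential L w₀ w₁ φ ϑ n :=
    potential_congr hr w₀ w₁ φ ϑ (intCast_val_intCast n)
  rw [hamiltonian_apply]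
  simp only [PiLp.add_apply, act_apply, cellPotential, h, Matrix.add_apply, add_mul,
    Finset.sum_add_distrib, add_assoc]

end DiracHarper

end

theorem proposition3p1 (L w₀ w₁ θ φ ϑ : ℝ) (hL : 0 < L) (hrat : ∃ r : ℚ, 1 / L = (r : ℝ))
    (hw₀ : 0 ≤ w₀) (hw₁ : 0 ≤ w₁) (hϑ : ϑ ∈ Set.Icc (0 : ℝ) 1) :
    SpectralTheory.HasPurelyACSpectrum (DiracHarper.hamiltonian L w₀ w₁ θ φ ϑ) ∧
      ∃ ν : MeasureTheory.Measure ℝ,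
        DiracHarper.IsDensityOfStates (DiracHarper.hamiltonian L w₀ w₁ θ φ ϑ) ν ∧
          Continuous (fun E : ℝ => ν.real (Set.Iic E)) ∧
          ∀ E : ℝ, Filter.Tendsto
            (fun N : ℕ => DiracHarper.localIDS (DiracHarper.hamiltonian L w₀ w₁ θ φ ϑ) N E)
            Filter.atTop (nhds (ν.real (Set.Iic E))) := by
  obtain ⟨r, hr⟩ := hrat
  have : NeZero r.den := ⟨r.den_nz⟩
  have hT := DiracHarper.isPeriodicJacobi_hamiltonian hr w₀ w₁ θ φ ϑ
  have hsa := DiracHarper.isSelfAdjoint_hamiltonian L w₀ w₁ θ φ ϑ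
  have ht := DiracHarper.isHermitian_hopping θ
  have hB := DiracHarper.isHermitian_cellPotential r.den L w₀ w₁ φ ϑ
  have hac := hT.hasPurelyACSpectrum hsa ht (DiracHarper.isUnit_hopping θ) hB
  exact ⟨hac, DiracHarper.periodicDensityOfStates r.den _, hT.isDensityOfStates hsa ht hB,
    continuous_measureReal_Iic _ (DiracHarper.periodicDensityOfStates_absolutelyContinuous _ hac),
    hT.tendsto_localIDS hsa ht hB⟩
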